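/- **Model.** Time is slotted. Let $r>0$ with $1/r\in\mathbb N$. $N\ge 1$ sensors sample synchronously and periodically, batch $b\ge1$ being sampled at $t_b=b/r$ (and $t_0=0$). The change time $T\in\{0,1,2,\dots\}$ satisfies $P(T=0)=\rho$ and $P(T=k\mid T>0)=p(1-p)^{k-1}$ for $k\ge1$, where $0\le\rho<1$ and $0<p\le1$. Given $T$, the sensor outputs $X_b^{(i)}$ ($b\ge1$, $1\le i\le N$), with values in an arbitrary measurable space, are independent, with law $F_0$ if $t_b<T$ and $F_1$ if $t_b\ge T$. Component $i$ of batch $b$ reaches the fusion center after a network delay $D_b^{(i)}\in\{1,2,\dots\}$; the complete batch is received at $U_b=t_b+D_b$, where $D_b=\max_i D_b^{(i)}$ is its sojourn time. The family of network delays is independent of the change time, of the sensor outputs, and of the decision maker's external randomization. The latter is a variable $V$ that is uniform on $[0,1]$ and independent of $(T,(X_b^{(i)}))$. Let $K=\min\{b\ge0: t_b\ge T\}$. A (network oblivious, possibly randomized) detection policy is an almost surely finite stopping time $\widetilde K\in\{0,1,2,\dots\}$ of the filtration $\sigma(V,X_1,\dots,X_b)$, $b\ge0$, where $X_b=(X_b^{(1)},\dots,X_b^{(N)})$.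 Put $\widetilde T=t_{\widetilde K}$ and $\widetilde U=U_{\widetilde K}$; stopping at $\widetilde K=0$, before the first batch, is charged a sojourn time $D_0$, i.e. $U_0=t_0+D_0$, where $D_0=\max_iD_0^{(i)}$ and the $D_0^{(i)}\ge1$ belong to the family of delays above. Let $\Pi_\alpha$ be the set of policies with $P(\widetilde T<T)\le\alpha$. Put $$p_r=1-(1-p)^{1/r},\qquad l(r)=\frac1r-\Big(\frac1p-\frac{1-p_r}{r\,p_r}\Big).$$ **Theorem.** Let $0<\alpha<1-\rho$. Then $l(r)=E\big[K/r-T\mid T>0\big]$ is the mean coarse-sampling delay. If the sojourn time process $D_0,D_1,D_2,\dots$ is stationary with finite mean $d(r)$, then both minima below are attained and finite, and $$\min_{\Pi_\alpha}E\big[(\widetilde U-T)\mathbf 1_{\{\widetilde T\ge T\}}\big]=(d(r)+l(r))(1-\alpha)-\rho\,l(r)+\frac1r\min_{\Pi_\alpha}E\big[(\widetilde K-K)^+\big].$$ If only $D_1,D_2,\dots$ is assumed to be stationary with finite mean $d(r)$, and $\alpha\le(1-\rho)(1-p_r)=P(K>1)$, then the same holds, with both minima attained and finite, when $\Pi_\alpha$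 is replaced on both sides by the set of those policies in $\Pi_\alpha$ for which $\widetilde K\ge1$ almost surely. -/

import Mathlib

open MeasureTheory ProbabilityTheory
open scoped ENNReal

noncomputable section

namespace NODM

/-- Probability that a change which has not yet occurred occurs within one sampling period
`1 / r`, when `p` is the probability of a change per slot: `p_r = 1 - (1 - p) ^ (1 / r)`. -/
def sampledChangeProb (p r : ℝ) : ℝ := 1 - (1 - p) ^ (1 / r)

/-- The coarse-sampling delay `l(r) = 1/r - (1/p - (1 - p_r) / (r p_r))`. -/
def coarseDelay (p r : ℝ) : ℝ :=
  1 / r - (1 / p - 1 / (r * sampledChangeProb p r) * (1 - sampledChangeProb p r))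

/-- `N` sensors sample synchronously and periodically at rate `r` (samples per slot, with `1 / r`
an integer), batch `b ≥ 1` being sampled at time `b / r`. The change time `T` has a (zero-modified)
geometric law with parameters `ρ` and `p`; the sensor outputs have law `F₀` before and `F₁` after
the change; `V` is the external randomization available to the decision maker; the packets are
delayed by a network whose delays are independent of what the packets carry.

Batches are indexed by `b ≥ 1`; the values `X 0 i` are never used, and `delay 0 i` only enters
through the cost of stopping before the first batch. -/
structure Model {Ω 𝒳 : Type*} [MeasurableSpace Ω] [MeasurableSpace 𝒳] (P : Measure Ω)
    (F₀ F₁ : Measure 𝒳) (N : ℕ) (r ρ p : ℝ) where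
  /-- the sampling period `1 / r`, in slots -/
  period : ℕ
  rate_pos : 0 < r
  period_eq : (period : ℝ) = 1 / r
  /-- the change time, in slots -/
  T : Ω → ℕ
  /-- `X b i` is the output of sensor `i` in batch `b` -/
  X : ℕ → Fin N → Ω → 𝒳
  /-- the external randomization -/
  V : Ω → ℝ
  /-- `delay b i` is the network delay, in slots, of the `i`th component of batch `b` -/
  delay : ℕ → Fin N → Ω → ℕ
  measurable_T : Measurable T
  measurable_X : ∀ b i, Measurable (X b i)
  measurable_V : Measurable V
  measurable_delay : ∀ b i, Measurable (delay b i)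
  /-- `P(T = 0) = ρ` -/
  prob_T_zero : P (T ⁻¹' {0}) = ENNReal.ofReal ρ
  /-- `P(T = k | T > 0) = p (1 - p) ^ (k - 1)` for `k ≥ 1` -/
  prob_T_succ : ∀ k : ℕ, P[T ⁻¹' {k + 1} | {ω | 0 < T ω}] = ENNReal.ofReal (p * (1 - p) ^ k)
  /-- given the change time, the sensor outputs are independent across sensors and batches -/
  indep_X : ∀ t : ℕ, P (T ⁻¹' {t}) ≠ 0 →
    iIndepFun (fun (q : {b : ℕ // 1 ≤ b} × Fin N) => X q.1 q.2) (P[|T ⁻¹' {t}])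
  /-- given `T = t`, an output of batch `b` has law `F₁` if `t ≤ b / r`, and `F₀` otherwise -/
  law_X : ∀ t : ℕ, P (T ⁻¹' {t}) ≠ 0 → ∀ b : ℕ, 1 ≤ b → ∀ i : Fin N,
    (P[|T ⁻¹' {t}]).map (X b i) = if t ≤ b * period then F₁ else F₀
  /-- the external randomization is uniform on `[0, 1]` -/
  law_V : P.map V = volume.restrict (Set.Icc (0 : ℝ) 1)
  /-- the external randomization is independent of the change time and the sensor outputs -/
  indep_V : IndepFun V (fun ω => (T ω, fun (b : ℕ) i => X (b + 1) i ω)) P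
  one_le_delay : ∀ b i ω, 1 ≤ delay b i ω
  /-- the network delays are independent of the change time, the sensor outputs and the
  external randomization -/
  indep_delay : IndepFun (fun ω b i => delay b i ω)
    (fun ω => (T ω, (fun (b : ℕ) i => X (b + 1) i ω), V ω)) P

namespace Model

variable {Ω 𝒳 : Type*} [MeasurableSpace Ω] [MeasurableSpace 𝒳] {P : Measure Ω}
  {F₀ F₁ : Measure 𝒳} {N : ℕ} {r ρ p : ℝ} (S : Model P F₀ F₁ N r ρ p)

/-- The sampling instant `t_b = b / r`. -/
def samplingTime (b : ℕ) : ℕ := b * S.period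

/-- `K`, the index of the first sampling instant at which the change has occurred. -/
def K (ω : Ω) : ℕ := sInf {b : ℕ | S.T ω ≤ S.samplingTime b}

/-- The sojourn time `D_b` of batch `b`. -/
def sojourn (b : ℕ) (ω : Ω) : ℕ := Finset.univ.sup fun i => S.delay b i ω

/-- `U_b = t_b + D_b`, the instant at which the complete batch `b` is received. -/
def arrival (b : ℕ) (ω : Ω) : ℕ := S.samplingTime b + S.sojourn b ω

/-- The sojourn times `D_{b₀}, D_{b₀ + 1}, …` form a stationary process with mean `d`. -/
def SojournStationary (b₀ : ℕ) (d : ℝ) : Prop :=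
  IdentDistrib (fun ω (b : ℕ) => S.sojourn (b₀ + b) ω) (fun ω (b : ℕ) => S.sojourn (b₀ + b + 1) ω)
    P P ∧
  Integrable (fun ω => (S.sojourn b₀ ω : ℝ)) P ∧ ∫ ω, (S.sojourn b₀ ω : ℝ) ∂P = d

/-- The information of the network oblivious decision maker once it has `b` batches: the
external randomization and the contents `X_1, …, X_b`, but no arrival times. -/
def info : Filtration ℕ (inferInstance : MeasurableSpace Ω) where
  seq b := MeasurableSpace.comap S.V inferInstance ⊔
    ⨆ k ∈ Finset.Icc 1 b, ⨆ i, MeasurableSpace.comap (S.X k i) inferInstance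
  mono' := fun a b hab => sup_le_sup_left
    (biSup_mono fun k hk => by simp only [Finset.mem_Icc] at hk ⊢; omega) _
  le' := fun _ => sup_le S.measurable_V.comap_le
    (iSup₂_le fun k _ => iSup_le fun i => (S.measurable_X k i).comap_le)

/-- A (possibly randomized) detection policy: an almost surely finite stopping time of the
filtration generated by the batches and the external randomization. -/
structure Policy where
  stopIndex : Ω → WithTop ℕ
  isStoppingTime : IsStoppingTime S.info stopIndex
  finite : ∀ᵐ ω ∂P, stopIndex ω ≠ ⊤

namespace Policy

variable {S} (π : S.Policy)

/-- `K̃`, the batch index at which the policy stops (the value on the null set on which it never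
stops is irrelevant). -/
def Kt (ω : Ω) : ℕ := (π.stopIndex ω).untopD 0

/-- `T̃ = t_K̃`, the stopping time if there were no network delay. -/
def Tt (ω : Ω) : ℕ := S.samplingTime (π.Kt ω)

/-- `Ũ = U_K̃`, the stopping time in the presence of network delay. -/
def Ut (ω : Ω) : ℕ := S.arrival (π.Kt ω) ω

/-- The probability of false alarm `P(T̃ < T)`. -/
def falseAlarm : ℝ≥0∞ := P {ω | π.Tt ω < S.T ω}

/-- The mean detection delay `E[(Ũ - T) 1{T̃ ≥ T}]`; the integrand is nonnegative and the
expectation may be infinite. -/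
def meanDetectionDelay : ℝ≥0∞ :=
  ∫⁻ ω, ENNReal.ofReal (({ω' | S.T ω' ≤ π.Tt ω'} : Set Ω).indicator
    (fun ω' => (π.Ut ω' : ℝ) - (S.T ω' : ℝ)) ω) ∂P

/-- The mean delay, in batches, of change detection at the sampling instants,
`E[(K̃ - K)⁺]`. -/
def meanSampledDelay : ℝ≥0∞ :=
  ∫⁻ ω, ENNReal.ofReal (((π.Kt ω : ℝ) - (S.K ω : ℝ)) ⊔ 0) ∂P

end Policy

/-- `Π_α`: the policies whose probability of false alarm is at most `α`. -/
def policies (α : ℝ) : Set S.Policy := {π | π.falseAlarm ≤ ENNReal.ofReal α}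

/-- The policies in `Π_α` that almost surely do not stop before the first batch is received. -/
def waitingPolicies (α : ℝ) : Set S.Policy :=
  {π | π ∈ S.policies α ∧ ∀ᵐ ω ∂P, 1 ≤ π.Kt ω}

end Model

end NODM

end

open Filter Topology in
/-- A decreasing sequence of nonempty, midpoint convex sets of measurable functions with values in
`[0, 1]` admits a selection that converges almost everywhere. -/
theorem NODM.exists_seq_mem_ae_tendsto {E : Type*} [MeasurableSpace E] (μ : Measure E)
    [IsFiniteMeasure μ] (C : ℕ → Set (E → ℝ)) (hC : Antitone C) (hne : ∀ k, (C k).Nonempty)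
    (hmeas : ∀ g ∈ C 0, Measurable g) (hbd : ∀ g ∈ C 0, ∀ x, g x ∈ Set.Icc (0 : ℝ) 1)
    (hmid : ∀ k, ∀ g ∈ C k, ∀ h ∈ C k, (fun x => (g x + h x) / 2) ∈ C k) :
    ∃ g : ℕ → E → ℝ, (∀ k, g k ∈ C k) ∧
      ∀ᵐ x ∂μ, ∃ l, Tendsto (fun k => g k x) atTop (𝓝 l) := by
  have hC0 : ∀ k, C k ⊆ C 0 := fun k => hC (Nat.zero_le k)
  have hsqi : ∀ g ∈ C 0, Integrable (fun x => g x ^ 2) μ := fun g hg =>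
    Integrable.of_bound ((hmeas g hg).pow_const 2).aestronglyMeasurable 1 <|
      Eventually.of_forall fun x => by
        have := hbd g hg x
        rw [Real.norm_of_nonneg (sq_nonneg _)]
        nlinarith [this.1, this.2]
  have hmul : ∀ g ∈ C 0, ∀ h ∈ C 0, Integrable (fun x => g x * h x) μ := fun g hg h hh =>
    Integrable.of_bound ((hmeas g hg).mul (hmeas h hh)).aestronglyMeasurable 1 <|
      Eventually.of_forall fun x => by
        have h1 := hbd g hg x
        have h2 := hbd h hh x
        rw [Real.norm_of_nonneg (mul_nonneg h1.1 h2.1)]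
        exact mul_le_one₀ h1.2 h2.1 h2.2
  set J : (E → ℝ) → ℝ := fun g => ∫ x, g x ^ 2 ∂μ with hJ
  have hJ0 : ∀ g, 0 ≤ J g := fun g => integral_nonneg fun x => sq_nonneg _
  have hJ1 : ∀ g ∈ C 0, J g ≤ μ.real Set.univ := fun g hg => by
    calc J g ≤ ∫ _, (1 : ℝ) ∂μ := integral_mono (hsqi g hg) (integrable_const _) fun x => by
          have := hbd g hg x
          simp only
          nlinarith [this.1, this.2]
      _ = _ := by simp
  have hpar : ∀ g ∈ C 0, ∀ h ∈ C 0,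
      ∫ x, (g x - h x) ^ 2 ∂μ = 2 * J g + 2 * J h - 4 * J (fun x => (g x + h x) / 2) := by
    intro g hg h hh
    have hsum : Integrable (fun x => g x ^ 2 + h x ^ 2) μ := (hsqi g hg).add (hsqi h hh)
    have e1 : ∫ x, (g x - h x) ^ 2 ∂μ = J g + J h - 2 * ∫ x, g x * h x ∂μ := by
      rw [← integral_add (hsqi g hg) (hsqi h hh), ← integral_const_mul,
        ← integral_sub hsum ((hmul g hg h hh).const_mul 2)]
      exact integral_congr_ae (Eventually.of_forall fun x => by simp; ring)
    have e2 : 4 * J (fun x => (g x + h x) / 2) = J g + J h + 2 * ∫ x, g x * h x ∂μ := by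
      rw [← integral_add (hsqi g hg) (hsqi h hh), ← integral_const_mul, ← integral_const_mul,
        ← integral_add hsum ((hmul g hg h hh).const_mul 2)]
      exact integral_congr_ae (Eventually.of_forall fun x => by simp; ring)
    linarith
  set s : ℕ → ℝ := fun k => sInf (J '' C k) with hs
  have hbdd : ∀ k, BddBelow (J '' C k) := fun k => ⟨0, by rintro _ ⟨g, -, rfl⟩; exact hJ0 g⟩
  have hsle : ∀ k, ∀ g ∈ C k, s k ≤ J g := fun k g hg => csInf_le (hbdd k) ⟨g, hg, rfl⟩
  have hsmono : Monotone s := fun i j hij =>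
    csInf_le_csInf (hbdd i) ((hne j).image J) (Set.image_mono (hC hij))
  have hsbd : BddAbove (Set.range s) := ⟨μ.real Set.univ, by
    rintro _ ⟨k, rfl⟩
    obtain ⟨g, hg⟩ := hne k
    exact (hsle k g hg).trans (hJ1 g (hC0 k hg))⟩
  have hslim := tendsto_atTop_ciSup hsmono hsbd
  set L := ⨆ k, s k
  have hchoose : ∀ k : ℕ, ∃ g ∈ C k, J g < s k + 1 / ((k : ℝ) + 1) := fun k => by
    obtain ⟨_, ⟨g, hg, rfl⟩, h⟩ := exists_lt_of_csInf_lt ((hne k).image J)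
      (show sInf (J '' C k) < s k + 1 / ((k : ℝ) + 1) by
        have : (0 : ℝ) < 1 / ((k : ℝ) + 1) := by positivity
        simp only [hs]; linarith)
    exact ⟨g, hg, h⟩
  choose g hgC hgJ using hchoose
  have hdist : ∀ i j, i ≤ j →
      ∫ x, (g i x - g j x) ^ 2 ∂μ ≤ 2 * (L - s i) + 4 * (1 / ((i : ℝ) + 1)) := by
    intro i j hij
    rw [hpar _ (hC0 i (hgC i)) _ (hC0 j (hgC j))]
    have h1 := hsle i _ (hmid i _ (hgC i) _ (hC hij (hgC j)))
    have h2 := hgJ i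
    have h3 := hgJ j
    have h4 : s j ≤ L := le_ciSup hsbd j
    have h5 : 1 / ((j : ℝ) + 1) ≤ 1 / ((i : ℝ) + 1) := by gcongr
    linarith
  have hlim0 : Tendsto (fun i : ℕ => 2 * (L - s i) + 4 * (1 / ((i : ℝ) + 1))) atTop (𝓝 0) := by
    have := ((hslim.const_sub L).const_mul 2).add
      ((tendsto_one_div_add_atTop_nhds_zero_nat (𝕜 := ℝ)).const_mul 4)
    simpa using this
  obtain ⟨φ, hφ, hφ'⟩ := extraction_forall_of_eventually' (P := fun n k =>
      ∀ i ≥ k, ∀ j ≥ k, ∫ x, (g i x - g j x) ^ 2 ∂μ < ((1 / 2 : ℝ) ^ n) ^ 2) (by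
    intro n
    obtain ⟨k₀, hk₀⟩ := eventually_atTop.1
      (hlim0.eventually_lt_const (show (0 : ℝ) < ((1 / 2 : ℝ) ^ n) ^ 2 by positivity))
    refine ⟨k₀, fun k hk i hi j hj => ?_⟩
    rcases le_total i j with hij | hij
    · exact (hdist i j hij).trans_lt (hk₀ i (hk.trans hi))
    · refine lt_of_eq_of_lt ?_ ((hdist j i hij).trans_lt (hk₀ j (hk.trans hj)))
      exact integral_congr_ae (Eventually.of_forall fun x => by simp only; ring))
  refine ⟨fun k => g (φ k), fun k => hC (hφ.id_le k) (hgC _), ?_⟩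
  have hgm : ∀ k, Measurable (g k) := fun k => hmeas _ (hC0 _ (hgC k))
  refine Lp.ae_tendsto_of_cauchy_eLpNorm (p := 2) (fun k => (hgm (φ k)).aestronglyMeasurable)
    (by norm_num) (B := fun n => ENNReal.ofReal ((1 / 2 : ℝ) ^ n)) ?_ ?_
  · rw [← ENNReal.ofReal_tsum_of_nonneg (fun n => by positivity) summable_geometric_two]
    exact ENNReal.ofReal_ne_top
  · intro M n m hn hm
    have hlt := hφ' M (φ n) (hφ.monotone hn) (φ m) (hφ.monotone hm)
    have hmem : MemLp (g (φ n) - g (φ m)) 2 μ := by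
      refine MemLp.of_bound ((hgm _).sub (hgm _)).aestronglyMeasurable 1
        (Eventually.of_forall fun x => ?_)
      have h1 := hbd _ (hC0 _ (hgC (φ n))) x
      have h2 := hbd _ (hC0 _ (hgC (φ m))) x
      rw [Pi.sub_apply, Real.norm_eq_abs, abs_le]
      constructor <;> linarith [h1.1, h1.2, h2.1, h2.2]
    rw [hmem.eLpNorm_eq_integral_rpow_norm (by norm_num) (by norm_num)]
    refine (ENNReal.ofReal_lt_ofReal_iff (by positivity)).2 ?_
    have : (∫ a, ‖(g (φ n) - g (φ m)) a‖ ^ (2 : ℝ≥0∞).toReal ∂μ)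
        = ∫ x, (g (φ n) x - g (φ m) x) ^ 2 ∂μ :=
      integral_congr_ae (Eventually.of_forall fun x => by simp)
    rw [this]
    have h2 : (2 : ℝ≥0∞).toReal⁻¹ = 1 / 2 := by norm_num
    rw [h2, ← Real.sqrt_eq_rpow]
    exact (Real.sqrt_lt' (by positivity)).2 hlt

namespace NODM

theorem sum_geometric_mul_eq (x : ℝ) (m : ℕ) :
    (1 - x) * ∑ j ∈ Finset.range m, ((m : ℝ) - 1 - j) * x ^ j
      = m - ∑ j ∈ Finset.range m, x ^ j := by
  induction m with
  | zero => simp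
  | succ m ih =>
    have h : ∑ j ∈ Finset.range m, (((m + 1 : ℕ) : ℝ) - 1 - j) * x ^ j
        = ∑ j ∈ Finset.range m, ((m : ℝ) - 1 - j) * x ^ j + ∑ j ∈ Finset.range m, x ^ j := by
      rw [← Finset.sum_add_distrib]
      refine Finset.sum_congr rfl fun j _ => ?_
      push_cast; ring
    have h2 := mul_neg_geom_sum x m
    rw [Finset.sum_range_succ, Finset.sum_range_succ, h, mul_add, mul_add, ih, h2]
    push_cast; ring

namespace Model

variable {Ω 𝒳 : Type*} [MeasurableSpace Ω] [MeasurableSpace 𝒳] {P : Measure Ω}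
  {F₀ F₁ : Measure 𝒳} {N : ℕ} {r ρ p : ℝ} (S : Model P F₀ F₁ N r ρ p)

theorem one_sub_sampledChangeProb (S : Model P F₀ F₁ N r ρ p) :
    1 - sampledChangeProb p r = (1 - p) ^ S.period := by
  rw [sampledChangeProb, ← S.period_eq, Real.rpow_natCast]; ring

theorem period_pos : 0 < S.period := by
  have h : (0 : ℝ) < S.period := by rw [S.period_eq]; exact one_div_pos.2 S.rate_pos
  exact_mod_cast h

/-- The coarse-sampling delay is the mean of `1 / r - s` for `s` geometric conditioned on being at
most `1 / r`. -/
theorem coarseDelay_mul_sum (hp : 0 < p) (hp' : p ≤ 1) :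
    coarseDelay p r * ∑ j ∈ Finset.range S.period, (1 - p) ^ j
      = ∑ j ∈ Finset.range S.period, ((S.period : ℝ) - 1 - j) * (1 - p) ^ j := by
  have h1 := S.one_sub_sampledChangeProb
  have hq : 0 < sampledChangeProb p r := by
    have : (1 - p) ^ S.period < 1 :=
      pow_lt_one₀ (by linarith) (by linarith) S.period_pos.ne'
    linarith
  have h2 := sum_geometric_mul_eq (1 - p) S.period
  have h3 := mul_neg_geom_sum (1 - p) S.period
  have h4 : p * ∑ j ∈ Finset.range S.period, (1 - p) ^ j = sampledChangeProb p r := by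
    rw [← h1] at h3; linarith
  have hr := S.period_eq
  have hl : coarseDelay p r = S.period / sampledChangeProb p r - 1 / p := by
    rw [coarseDelay, hr]
    have := S.rate_pos
    field_simp
    ring
  have h5 : ∑ j ∈ Finset.range S.period, (1 - p) ^ j = sampledChangeProb p r / p := by
    field_simp; linarith
  have h6 : ∑ j ∈ Finset.range S.period, ((S.period : ℝ) - 1 - j) * (1 - p) ^ j
      = (S.period - sampledChangeProb p r / p) / p := by
    rw [h5] at h2; field_simp at h2 ⊢; linarith
  rw [h5, h6, hl]
  field_simp

theorem coarseDelay_nonneg (S : Model P F₀ F₁ N r ρ p) (hp : 0 < p) (hp' : p ≤ 1) :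
    0 ≤ coarseDelay p r := by
  have h := S.coarseDelay_mul_sum hp hp'
  have hpos : 0 < ∑ j ∈ Finset.range S.period, (1 - p) ^ j := by
    obtain ⟨m, hm⟩ := Nat.exists_eq_succ_of_ne_zero S.period_pos.ne'
    rw [hm, Finset.sum_range_succ']
    have : 0 ≤ ∑ j ∈ Finset.range m, (1 - p) ^ (j + 1) :=
      Finset.sum_nonneg fun j _ => pow_nonneg (by linarith) _
    simp; linarith
  have hnn : 0 ≤ ∑ j ∈ Finset.range S.period, ((S.period : ℝ) - 1 - j) * (1 - p) ^ j :=
    Finset.sum_nonneg fun j hj => mul_nonneg (by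
      have : ((j + 1 : ℕ) : ℝ) ≤ S.period := by exact_mod_cast Finset.mem_range.1 hj
      push_cast at this; linarith) (pow_nonneg (by linarith) _)
  exact nonneg_of_mul_nonneg_left (h ▸ hnn) hpos

theorem K_le_iff (ω : Ω) (b : ℕ) : S.K ω ≤ b ↔ S.T ω ≤ b * S.period := by
  have hne : {b : ℕ | S.T ω ≤ S.samplingTime b}.Nonempty :=
    ⟨S.T ω, Nat.le_mul_of_pos_right _ S.period_pos⟩
  constructor
  · intro h
    exact (Nat.sInf_mem hne).trans (Nat.mul_le_mul_right _ h)
  · exact fun h => Nat.sInf_le h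

theorem T_le_K_mul (ω : Ω) : S.T ω ≤ S.K ω * S.period := (S.K_le_iff ω _).1 le_rfl

theorem K_eq_zero_iff (ω : Ω) : S.K ω = 0 ↔ S.T ω = 0 := by
  simpa using S.K_le_iff ω 0

theorem K_eq_succ_iff (ω : Ω) (κ : ℕ) :
    S.K ω = κ + 1 ↔ ∃ j < S.period, S.T ω = κ * S.period + 1 + j := by
  have h1 := S.K_le_iff ω (κ + 1)
  have h2 := S.K_le_iff ω κ
  rw [add_mul, one_mul] at h1
  constructor
  · intro h
    exact ⟨S.T ω - (κ * S.period + 1), by omega, by omega⟩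
  · rintro ⟨j, hj, h⟩
    omega

theorem measurable_K : Measurable S.K :=
  measurable_of_Iic fun b => by
    have : S.K ⁻¹' Set.Iic b = S.T ⁻¹' Set.Iic (b * S.period) := by
      ext ω; exact S.K_le_iff ω b
    rw [this]
    exact S.measurable_T measurableSet_Iic

theorem measurableSet_T_pos : MeasurableSet {ω | 0 < S.T ω} := S.measurable_T measurableSet_Ioi

theorem prob_T_pos [IsProbabilityMeasure P] (hρ : 0 ≤ ρ) :
    P {ω | 0 < S.T ω} = ENNReal.ofReal (1 - ρ) := by
  have : {ω | 0 < S.T ω} = (S.T ⁻¹' {0})ᶜ := by ext ω; simp [Nat.pos_iff_ne_zero]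
  rw [this, prob_compl_eq_one_sub (S.measurable_T (measurableSet_singleton 0)), S.prob_T_zero,
    ENNReal.ofReal_sub _ hρ, ENNReal.ofReal_one]

theorem prob_T_eq_succ [IsProbabilityMeasure P] (k : ℕ) :
    P (S.T ⁻¹' {k + 1}) = P {ω | 0 < S.T ω} * ENNReal.ofReal (p * (1 - p) ^ k) := by
  rw [← S.prob_T_succ k, mul_comm, cond_mul_eq_inter' S.measurableSet_T_pos (measure_ne_top _ _)]
  congr 1
  ext ω; simp; omega

theorem prob_T_add [IsProbabilityMeasure P] (hp : 0 < p) (hp' : p ≤ 1) (k j : ℕ) :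
    P (S.T ⁻¹' {k + 1 + j}) = P (S.T ⁻¹' {k + 1}) * ENNReal.ofReal ((1 - p) ^ j) := by
  rw [show k + 1 + j = k + j + 1 by ring, S.prob_T_eq_succ, S.prob_T_eq_succ, mul_assoc,
    ← ENNReal.ofReal_mul (mul_nonneg hp.le (pow_nonneg (by linarith) _)), pow_add, mul_assoc]

theorem prob_K_pos [IsProbabilityMeasure P] (hρ : 0 ≤ ρ) :
    P {ω | 0 < S.K ω} = ENNReal.ofReal (1 - ρ) := by
  rw [← S.prob_T_pos hρ]
  congr 1
  ext ω
  simp [Nat.pos_iff_ne_zero, S.K_eq_zero_iff]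

theorem prob_K_gt_one [IsProbabilityMeasure P] (hρ : 0 ≤ ρ) (hρ' : ρ ≤ 1) (hp : 0 < p)
    (hp' : p ≤ 1) :
    P {ω | 1 < S.K ω} = ENNReal.ofReal ((1 - ρ) * (1 - sampledChangeProb p r)) := by
  have hset : {ω | 0 < S.T ω} =
      {ω | 1 < S.K ω} ∪ ⋃ j ∈ Finset.range S.period, S.T ⁻¹' {j + 1} := by
    ext ω
    have := S.K_le_iff ω 1
    simp only [one_mul] at this
    simp only [Set.mem_ofPred_eq, Set.mem_union, Set.mem_iUnion, Finset.mem_range,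
      Set.mem_preimage, Set.mem_singleton_iff, exists_prop]
    constructor
    · intro h
      by_cases hK : 1 < S.K ω
      · exact Or.inl hK
      · exact Or.inr ⟨S.T ω - 1, by omega, by omega⟩
    · rintro (h | ⟨j, hj, h⟩) <;> omega
  have hdisj : Disjoint {ω | 1 < S.K ω} (⋃ j ∈ Finset.range S.period, S.T ⁻¹' {j + 1}) := by
    rw [Set.disjoint_left]
    intro ω h h'
    have := S.K_le_iff ω 1
    simp only [one_mul] at this
    simp only [Set.mem_ofPred_eq, Set.mem_iUnion, Finset.mem_range,
      Set.mem_preimage, Set.mem_singleton_iff, exists_prop] at h h'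
    obtain ⟨j, hj, h'⟩ := h'
    omega
  have hsum : P (⋃ j ∈ Finset.range S.period, S.T ⁻¹' {j + 1})
      = ENNReal.ofReal (1 - ρ) * ENNReal.ofReal (sampledChangeProb p r) := by
    rw [measure_biUnion_finset (fun i _ j _ hij => Set.disjoint_left.2 fun ω h h' => hij (by
        simp at h h'; omega)) fun j _ => S.measurable_T (measurableSet_singleton _)]
    simp_rw [S.prob_T_eq_succ, S.prob_T_pos hρ, ← Finset.mul_sum]
    rw [← ENNReal.ofReal_sum_of_nonneg fun j _ => mul_nonneg hp.le (pow_nonneg (by linarith) _),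
      ← Finset.mul_sum]
    have h3 := mul_neg_geom_sum (1 - p) S.period
    rw [sub_sub_cancel, ← S.one_sub_sampledChangeProb, sub_sub_cancel] at h3
    rw [h3]
  have hq : 0 ≤ 1 - sampledChangeProb p r := by
    rw [S.one_sub_sampledChangeProb]; exact pow_nonneg (by linarith) _
  have hq' : 0 ≤ sampledChangeProb p r := by
    have h : (1 - p) ^ S.period ≤ 1 := pow_le_one₀ (by linarith) (by linarith)
    rw [← S.one_sub_sampledChangeProb] at h
    linarith
  have htot := S.prob_T_pos hρ
  rw [hset, measure_union hdisj (.biUnion (Finset.range S.period).countable_toSet fun j _ =>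
    S.measurable_T (measurableSet_singleton _)), hsum] at htot
  refine (ENNReal.add_left_inj (a := ENNReal.ofReal (1 - ρ) *
    ENNReal.ofReal (sampledChangeProb p r)) (by finiteness)).1 ?_
  rw [htot, ← ENNReal.ofReal_mul (by linarith), ← ENNReal.ofReal_add
    (mul_nonneg (by linarith) hq) (mul_nonneg (by linarith) hq')]
  congr 1; ring

end Model
end NODM

namespace NODM

theorem lintegral_comp_prodMk_of_indepFun {Ω α β : Type*} [MeasurableSpace Ω] [MeasurableSpace α]
    [MeasurableSpace β] {P : Measure Ω} [IsProbabilityMeasure P] {V : Ω → α} {Y : Ω → β}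
    (hV : Measurable V) (hY : Measurable Y) (h : IndepFun V Y P) {H : α × β → ℝ≥0∞}
    (hH : Measurable H) :
    ∫⁻ ω, H (V ω, Y ω) ∂P = ∫⁻ ω, ∫⁻ v, H (v, Y ω) ∂(P.map V) ∂P := by
  have := Measure.isProbabilityMeasure_map (μ := P) hV.aemeasurable
  have := Measure.isProbabilityMeasure_map (μ := P) hY.aemeasurable
  rw [← lintegral_map hH (hV.prodMk hY),
    (indepFun_iff_map_prod_eq_prod_map_map hV.aemeasurable hY.aemeasurable).1 h,
    lintegral_prod_symm' _ hH, lintegral_map hH.lintegral_prod_left' hY]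

namespace Model

variable {Ω 𝒳 : Type*} [MeasurableSpace Ω] [MeasurableSpace 𝒳] {P : Measure Ω}
  {F₀ F₁ : Measure 𝒳} {N : ℕ} {r ρ p : ℝ} (S : Model P F₀ F₁ N r ρ p)

/-- The sensor outputs of all the batches. -/
def path (ω : Ω) : ℕ → Fin N → 𝒳 := fun b i => S.X (b + 1) i ω

theorem measurable_path : Measurable S.path :=
  measurable_pi_lambda _ fun b => measurable_pi_lambda _ fun i => S.measurable_X (b + 1) i

/-- All that the decision maker can ever observe: the randomization and the sensor outputs. -/
abbrev observations : MeasurableSpace Ω :=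
  MeasurableSpace.comap (fun ω => (S.V ω, S.path ω)) inferInstance

theorem observations_le : S.observations ≤ (inferInstance : MeasurableSpace Ω) :=
  (S.measurable_V.prodMk S.measurable_path).comap_le

theorem info_le_observations (n : ℕ) : S.info n ≤ S.observations := by
  have h : Measurable[S.observations] fun ω => (S.V ω, S.path ω) := comap_measurable _
  refine sup_le (measurable_fst.comp h).comap_le (iSup₂_le fun k hk => iSup_le fun i => ?_)
  have hk1 : 1 ≤ k := (Finset.mem_Icc.1 hk).1
  obtain ⟨b, rfl⟩ : ∃ b, k = b + 1 := ⟨k - 1, by omega⟩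
  exact Measurable.comap_le ((measurable_pi_apply i).comp
    ((measurable_pi_apply b).comp (measurable_snd.comp h)))

/-- Given the change time `t`, the law of the sensor outputs depends on `t` only through the batch
by which the change has occurred. -/
theorem map_path_cond_eq [IsProbabilityMeasure P] {t t' : ℕ} (ht : P (S.T ⁻¹' {t}) ≠ 0)
    (ht' : P (S.T ⁻¹' {t'}) ≠ 0)
    (h : ∀ b : ℕ, 1 ≤ b → (t ≤ b * S.period ↔ t' ≤ b * S.period)) :
    (P[|S.T ⁻¹' {t}]).map S.path = (P[|S.T ⁻¹' {t'}]).map S.path := by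
  have := cond_isProbabilityMeasure ht
  have := cond_isProbabilityMeasure ht'
  have hm : ∀ q : {b : ℕ // 1 ≤ b} × Fin N, Measurable (S.X q.1 q.2) :=
    fun q => S.measurable_X _ _
  have hmW : Measurable fun ω (q : {b : ℕ // 1 ≤ b} × Fin N) => S.X q.1 q.2 ω :=
    measurable_pi_lambda _ hm
  have e1 := (iIndepFun_iff_map_fun_eq_infinitePi_map hm).1 (S.indep_X t ht)
  have e2 := (iIndepFun_iff_map_fun_eq_infinitePi_map hm).1 (S.indep_X t' ht')
  have hlaw : (fun q : {b : ℕ // 1 ≤ b} × Fin N => (P[|S.T ⁻¹' {t}]).map (S.X q.1 q.2))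
      = fun q => (P[|S.T ⁻¹' {t'}]).map (S.X q.1 q.2) := by
    funext q
    rw [S.law_X t ht _ q.1.2, S.law_X t' ht' _ q.1.2]
    simp only [h _ q.1.2]
  rw [hlaw, ← e2] at e1
  let g : ({b : ℕ // 1 ≤ b} × Fin N → 𝒳) → ℕ → Fin N → 𝒳 :=
    fun w b i => w (⟨b + 1, by omega⟩, i)
  have hg : Measurable g := measurable_pi_lambda _ fun b => measurable_pi_lambda _ fun i =>
    measurable_pi_apply _
  have hcomp : S.path = g ∘ fun ω (q : {b : ℕ // 1 ≤ b} × Fin N) => S.X q.1 q.2 ω := rfl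
  rw [hcomp, ← Measure.map_map hg hmW, ← Measure.map_map hg hmW, e1]

theorem measure_inter_T_mul [IsProbabilityMeasure P] {A : Set Ω}
    (hA : MeasurableSet[S.observations] A) {t t' : ℕ}
    (h : ∀ b : ℕ, 1 ≤ b → (t ≤ b * S.period ↔ t' ≤ b * S.period)) :
    P (A ∩ S.T ⁻¹' {t}) * P (S.T ⁻¹' {t'}) = P (A ∩ S.T ⁻¹' {t'}) * P (S.T ⁻¹' {t}) := by
  by_cases ht : P (S.T ⁻¹' {t}) = 0
  · rw [ht, measure_mono_null Set.inter_subset_right ht, zero_mul, mul_zero]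
  by_cases ht' : P (S.T ⁻¹' {t'}) = 0
  · rw [ht', measure_mono_null Set.inter_subset_right ht', zero_mul, mul_zero]
  obtain ⟨B, hB, rfl⟩ := hA
  let u : (ℕ → Fin N → 𝒳) → ℝ≥0∞ := fun y => P.map S.V {v | (v, y) ∈ B}
  have := Measure.isProbabilityMeasure_map (μ := P) S.measurable_V.aemeasurable
  have hu : Measurable u := measurable_measure_prodMk_right hB
  have key : ∀ s : ℕ, P (S.T ⁻¹' {s}) ≠ 0 →
      P ((fun ω => (S.V ω, S.path ω)) ⁻¹' B ∩ S.T ⁻¹' {s})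
        = P (S.T ⁻¹' {s}) * ∫⁻ y, u y ∂((P[|S.T ⁻¹' {s}]).map S.path) := by
    intro s hs
    have hTs : MeasurableSet (S.T ⁻¹' {s}) := S.measurable_T (measurableSet_singleton s)
    let H : ℝ × (ℕ × (ℕ → Fin N → 𝒳)) → ℝ≥0∞ :=
      {z | (z.1, z.2.2) ∈ B ∧ z.2.1 = s}.indicator 1
    have hHset : MeasurableSet {z : ℝ × (ℕ × (ℕ → Fin N → 𝒳)) | (z.1, z.2.2) ∈ B ∧ z.2.1 = s} :=
      ((measurable_fst.prodMk measurable_snd.snd) hB).inter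
        (measurable_snd.fst (measurableSet_singleton s))
    have hH : Measurable H := measurable_one.indicator hHset
    have e := lintegral_comp_prodMk_of_indepFun S.measurable_V
      (S.measurable_T.prodMk S.measurable_path) S.indep_V hH
    have e1 : ∫⁻ ω, H (S.V ω, (S.T ω, S.path ω)) ∂P
        = P ((fun ω => (S.V ω, S.path ω)) ⁻¹' B ∩ S.T ⁻¹' {s}) := by
      rw [← lintegral_indicator_one
        (((S.measurable_V.prodMk S.measurable_path) hB).inter hTs)]
      rfl
    have e2 : ∀ ω, ∫⁻ v, H (v, (S.T ω, S.path ω)) ∂(P.map S.V)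
        = (S.T ⁻¹' {s}).indicator (fun ω => u (S.path ω)) ω := by
      intro ω
      by_cases hω : S.T ω = s
      · rw [Set.indicator_of_mem (by exact hω)]
        refine Eq.trans ?_ (lintegral_indicator_one (measurable_prodMk_right hB))
        refine lintegral_congr fun v => ?_
        by_cases hv : (v, S.path ω) ∈ B <;> simp [H, hω, hv]
      · rw [Set.indicator_of_notMem (by exact hω)]
        simp [H, hω]
    rw [← e1]
    refine e.trans ?_
    simp_rw [e2]
    rw [lintegral_indicator hTs, lintegral_map hu S.measurable_path, ProbabilityTheory.cond,
      lintegral_smul_measure, smul_eq_mul, ← mul_assoc, ENNReal.mul_inv_cancel hs (measure_ne_top _ _), one_mul]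
  rw [key t ht, key t' ht', S.map_path_cond_eq ht ht' h]
  ring

theorem measure_inter_T_add [IsProbabilityMeasure P] (hp : 0 < p) (hp' : p ≤ 1) {A : Set Ω}
    (hA : MeasurableSet[S.observations] A) (κ j : ℕ) (hj : j < S.period) :
    P (A ∩ S.T ⁻¹' {κ * S.period + 1 + j})
      = P (A ∩ S.T ⁻¹' {κ * S.period + 1}) * ENNReal.ofReal ((1 - p) ^ j) := by
  have h := S.measure_inter_T_mul hA (t := κ * S.period + 1 + j) (t' := κ * S.period + 1) (by
    intro b hb
    constructor
    · intro h; omega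
    · intro h
      have h1 : κ < b := by
        by_contra hcon
        have := Nat.mul_le_mul_right S.period (not_lt.1 hcon)
        omega
      have := Nat.mul_le_mul_right S.period (Nat.succ_le_of_lt h1)
      rw [Nat.succ_mul] at this
      omega)
  rw [S.prob_T_add hp hp'] at h
  by_cases h0 : P (S.T ⁻¹' {κ * S.period + 1}) = 0
  · rw [measure_mono_null Set.inter_subset_right h0, zero_mul]
    exact measure_mono_null Set.inter_subset_right (by rw [S.prob_T_add hp hp', h0, zero_mul])
  · refine (ENNReal.mul_left_inj h0 (measure_ne_top _ _)).1 (h.trans ?_)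
    ring

theorem setLIntegral_sub_T_block [IsProbabilityMeasure P] (hp : 0 < p) (hp' : p ≤ 1) {A : Set Ω}
    (hA : MeasurableSet[S.observations] A) (κ : ℕ) :
    ∫⁻ ω in S.K ⁻¹' {κ + 1} ∩ A, ((S.K ω * S.period - S.T ω : ℕ) : ℝ≥0∞) ∂P
      = ENNReal.ofReal (coarseDelay p r) * P (S.K ⁻¹' {κ + 1} ∩ A) := by
  have hA' := S.observations_le _ hA
  have hset : S.K ⁻¹' {κ + 1} ∩ A
      = ⋃ j ∈ Finset.range S.period, A ∩ S.T ⁻¹' {κ * S.period + 1 + j} := by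
    ext ω
    have := S.K_eq_succ_iff ω κ
    simp only [Set.mem_inter_iff, Set.mem_preimage, Set.mem_singleton_iff, this, Set.mem_iUnion,
      Finset.mem_range, exists_prop]
    tauto
  have hmeas : ∀ j, MeasurableSet (A ∩ S.T ⁻¹' {κ * S.period + 1 + j}) :=
    fun j => hA'.inter (S.measurable_T (measurableSet_singleton _))
  have hdisj : Set.PairwiseDisjoint (↑(Finset.range S.period))
      fun j => A ∩ S.T ⁻¹' {κ * S.period + 1 + j} := fun i _ j _ hij =>
    Set.disjoint_left.2 fun ω h h' => hij (by
      have h1 : S.T ω = _ := h.2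
      have h2 : S.T ω = _ := h'.2
      omega)
  have hterm : ∀ j ∈ Finset.range S.period,
      ∫⁻ ω in A ∩ S.T ⁻¹' {κ * S.period + 1 + j}, ((S.K ω * S.period - S.T ω : ℕ) : ℝ≥0∞) ∂P
        = P (A ∩ S.T ⁻¹' {κ * S.period + 1})
          * ENNReal.ofReal (((S.period : ℝ) - 1 - j) * (1 - p) ^ j) := by
    intro j hj
    have hj := Finset.mem_range.1 hj
    rw [setLIntegral_congr_fun (g := fun _ => ((S.period - 1 - j : ℕ) : ℝ≥0∞)) (hmeas j)]
    · rw [setLIntegral_const, S.measure_inter_T_add hp hp' hA κ j hj, mul_left_comm,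
        ENNReal.ofReal_mul (by
          have : ((j + 1 : ℕ) : ℝ) ≤ S.period := by exact_mod_cast hj
          push_cast at this; linarith), ← ENNReal.ofReal_natCast]
      congr 3
      rw [Nat.cast_sub (by omega), Nat.cast_sub (by omega)]
      simp
    · intro ω hω
      have h1 : S.T ω = κ * S.period + 1 + j := hω.2
      have h2 : S.K ω = κ + 1 := (S.K_eq_succ_iff ω κ).2 ⟨j, hj, h1⟩
      simp only [h1, h2, add_mul, one_mul]
      congr 1
      omega
  rw [hset, lintegral_biUnion_finset hdisj fun j _ => hmeas j,
    measure_biUnion_finset hdisj fun j _ => hmeas j, Finset.sum_congr rfl hterm,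
    Finset.sum_congr rfl fun j hj => S.measure_inter_T_add hp hp' hA κ j (Finset.mem_range.1 hj),
    ← Finset.mul_sum, ← Finset.mul_sum, ← ENNReal.ofReal_sum_of_nonneg,
    ← ENNReal.ofReal_sum_of_nonneg fun j _ => pow_nonneg (by linarith) _,
    ← S.coarseDelay_mul_sum hp hp', ENNReal.ofReal_mul (S.coarseDelay_nonneg hp hp')]
  · ring
  · intro j hj
    have : ((j + 1 : ℕ) : ℝ) ≤ S.period := by exact_mod_cast Finset.mem_range.1 hj
    push_cast at this
    exact mul_nonneg (by linarith) (pow_nonneg (by linarith) _)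

/-- The coarse-sampling delay is uncorrelated with what is observed. -/
theorem setLIntegral_sub_T [IsProbabilityMeasure P] (hp : 0 < p) (hp' : p ≤ 1) {A : ℕ → Set Ω}
    (hA : ∀ κ, MeasurableSet[S.observations] (A κ)) :
    ∫⁻ ω in {ω | 0 < S.T ω ∧ ω ∈ A (S.K ω)}, ((S.K ω * S.period - S.T ω : ℕ) : ℝ≥0∞) ∂P
      = ENNReal.ofReal (coarseDelay p r) * P {ω | 0 < S.T ω ∧ ω ∈ A (S.K ω)} := by
  have hset : {ω | 0 < S.T ω ∧ ω ∈ A (S.K ω)} = ⋃ κ, S.K ⁻¹' {κ + 1} ∩ A (κ + 1) := by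
    ext ω
    have h0 := S.K_eq_zero_iff ω
    simp only [Set.mem_ofPred_eq, Set.mem_iUnion, Set.mem_inter_iff, Set.mem_preimage,
      Set.mem_singleton_iff]
    constructor
    · rintro ⟨h1, h2⟩
      have : S.K ω = S.K ω - 1 + 1 := by omega
      exact ⟨S.K ω - 1, this, this ▸ h2⟩
    · rintro ⟨κ, h1, h2⟩
      exact ⟨by omega, by rwa [h1]⟩
  have hmeas : ∀ κ, MeasurableSet (S.K ⁻¹' {κ + 1} ∩ A (κ + 1)) := fun κ =>
    (S.measurable_K (measurableSet_singleton _)).inter (S.observations_le _ (hA _))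
  have hdisj : Pairwise (Function.onFun Disjoint fun κ => S.K ⁻¹' {κ + 1} ∩ A (κ + 1)) :=
    fun i j hij => Set.disjoint_left.2 fun ω h h' => hij (by
      have h1 : S.K ω = _ := h.1
      have h2 : S.K ω = _ := h'.1
      omega)
  rw [hset, lintegral_iUnion hmeas hdisj, measure_iUnion hdisj hmeas, ← ENNReal.tsum_mul_left]
  exact tsum_congr fun κ => S.setLIntegral_sub_T_block hp hp' (hA _) κ

theorem integral_coarse_sampling_delay [IsProbabilityMeasure P] (hρ : 0 ≤ ρ) (hρ' : ρ < 1)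
    (hp : 0 < p) (hp' : p ≤ 1) :
    ∫ ω, ((S.K ω : ℝ) / r - (S.T ω : ℝ)) ∂(P[|{ω | 0 < S.T ω}]) = coarseDelay p r := by
  have h := S.setLIntegral_sub_T hp hp' (A := fun _ => Set.univ) fun _ => .univ
  simp only [Set.mem_univ, and_true] at h
  have hpos : P {ω | 0 < S.T ω} ≠ 0 := by
    rw [S.prob_T_pos hρ]; simpa using hρ'
  have hnn : ∀ ω, (S.K ω : ℝ) / r - (S.T ω : ℝ) = ((S.K ω * S.period - S.T ω : ℕ) : ℝ) := by
    intro ω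
    rw [Nat.cast_sub (S.T_le_K_mul ω), Nat.cast_mul, S.period_eq]
    ring
  simp_rw [hnn]
  have hmeas : Measurable fun ω => ((S.K ω * S.period - S.T ω : ℕ) : ℝ) :=
    (measurable_from_top (f := fun n : ℕ => (n : ℝ))).comp
      ((S.measurable_K.mul_const _).sub S.measurable_T)
  rw [integral_eq_lintegral_of_nonneg_ae (Filter.Eventually.of_forall fun ω => by positivity)
    hmeas.aestronglyMeasurable]
  simp_rw [ENNReal.ofReal_natCast]
  rw [ProbabilityTheory.cond, lintegral_smul_measure, h, smul_eq_mul, mul_left_comm,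
    ENNReal.inv_mul_cancel hpos (measure_ne_top _ _), mul_one,
    ENNReal.toReal_ofReal (S.coarseDelay_nonneg hp hp')]

end Model
end NODM

namespace NODM

theorem measurable_finset_sup_nat {α ι : Type*} [MeasurableSpace α] [Fintype ι] {f : ι → α → ℕ}
    (hf : ∀ i, Measurable (f i)) : Measurable fun x => Finset.univ.sup fun i => f i x :=
  measurable_of_Iic fun k => by
    have : (fun x => Finset.univ.sup fun i => f i x) ⁻¹' Set.Iic k = ⋂ i, f i ⁻¹' Set.Iic k := by
      ext x; simp
    rw [this]
    exact MeasurableSet.iInter fun i => hf i measurableSet_Iic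

theorem lintegral_mul_indicator_of_indepFun {Ω α β : Type*} [MeasurableSpace Ω]
    [MeasurableSpace α] [MeasurableSpace β] {P : Measure Ω} {D : Ω → α} {Z : Ω → β}
    (hD : Measurable D) (hZ : Measurable Z) (h : IndepFun D Z P) {f : α → ℝ≥0∞}
    (hf : Measurable f) {B : Set β} (hB : MeasurableSet B) :
    ∫⁻ ω, f (D ω) * (Z ⁻¹' B).indicator 1 ω ∂P = (∫⁻ ω, f (D ω) ∂P) * P (Z ⁻¹' B) := by
  rw [← lintegral_indicator_one (hZ hB)]
  have hg : Measurable (B.indicator (1 : β → ℝ≥0∞)) := measurable_one.indicator hB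
  exact lintegral_mul_eq_lintegral_mul_lintegral_of_indepFun (hf.comp hD) (hg.comp hZ)
    (h.comp hf hg)

namespace Model

variable {Ω 𝒳 : Type*} [MeasurableSpace Ω] [MeasurableSpace 𝒳] {P : Measure Ω}
  {F₀ F₁ : Measure 𝒳} {N : ℕ} {r ρ p : ℝ} {S : Model P F₀ F₁ N r ρ p}

namespace Policy

theorem T_le_Tt_iff (π : S.Policy) (ω : Ω) : S.T ω ≤ π.Tt ω ↔ S.K ω ≤ π.Kt ω :=
  (S.K_le_iff ω _).symm

theorem falseAlarm_eq (π : S.Policy) : π.falseAlarm = P {ω | π.Kt ω < S.K ω} := by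
  rw [falseAlarm]
  congr 1
  ext ω
  simpa using (π.T_le_Tt_iff ω).not

theorem ae_stopIndex_eq (π : S.Policy) : ∀ᵐ ω ∂P, π.stopIndex ω = (π.Kt ω : WithTop ℕ) := by
  filter_upwards [π.finite] with ω h
  rw [Kt]
  cases hk : π.stopIndex ω with
  | top => exact absurd hk h
  | coe n => rfl

theorem measurableSet_le (π : S.Policy) (n : ℕ) :
    MeasurableSet[S.info n] {ω | π.stopIndex ω ≤ n} := π.isStoppingTime n

theorem measurableSet_gt (π : S.Policy) (n : ℕ) :
    MeasurableSet[S.info n] {ω | (n : WithTop ℕ) < π.stopIndex ω} := by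
  have : {ω | (n : WithTop ℕ) < π.stopIndex ω} = {ω | π.stopIndex ω ≤ n}ᶜ := by
    ext ω; simp
  rw [this]
  exact (π.measurableSet_le n).compl

theorem measurableSet_ge (π : S.Policy) (n : ℕ) :
    MeasurableSet[S.info n] {ω | (n : WithTop ℕ) ≤ π.stopIndex ω} := by
  cases n with
  | zero => simp
  | succ n =>
    have : {ω | ((n + 1 : ℕ) : WithTop ℕ) ≤ π.stopIndex ω} = {ω | π.stopIndex ω ≤ n}ᶜ := by
      ext ω
      simp only [Set.mem_ofPred_eq, Set.mem_compl_iff, not_le]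
      cases π.stopIndex ω with
      | top => simp
      | coe k =>
        exact Iff.trans WithTop.coe_le_coe (Iff.trans Nat.succ_le_iff WithTop.coe_lt_coe.symm)
    rw [this]
    exact (S.info.mono n.le_succ _ (π.measurableSet_le n)).compl

theorem measurableSet_eq (π : S.Policy) (n : ℕ) :
    MeasurableSet[S.info n] {ω | π.stopIndex ω = n} := by
  have : {ω | π.stopIndex ω = n} =
      {ω | π.stopIndex ω ≤ n} ∩ {ω | (n : WithTop ℕ) ≤ π.stopIndex ω} := by
    ext ω; simp [le_antisymm_iff]
  rw [this]
  exact (π.measurableSet_le n).inter (π.measurableSet_ge n)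

theorem measurable_Kt (π : S.Policy) : Measurable π.Kt := by
  refine measurable_to_countable' fun n => ?_
  have htop : MeasurableSet {ω | π.stopIndex ω = ⊤} := by
    have : {ω | π.stopIndex ω = ⊤} = ⋂ n : ℕ, {ω | (n : WithTop ℕ) < π.stopIndex ω} := by
      ext ω
      simp only [Set.mem_ofPred_eq, Set.mem_iInter]
      exact ⟨fun h n => h ▸ WithTop.coe_lt_top n, fun h => WithTop.eq_top_iff_forall_gt.2 h⟩
    rw [this]
    exact MeasurableSet.iInter fun n => S.info.le n _ (π.measurableSet_gt n)
  have : π.Kt ⁻¹' {n} = {ω | π.stopIndex ω = n} ∪ ({ω | π.stopIndex ω = ⊤} ∩ {_ω | n = 0}) := by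
    ext ω
    simp only [Kt, Set.mem_preimage, Set.mem_singleton_iff, Set.mem_union, Set.mem_ofPred_eq,
      Set.mem_inter_iff]
    cases π.stopIndex ω with
    | top => simp [eq_comm]
    | coe k =>
      simp only [WithTop.coe_ne_top, false_and, or_false]
      exact (WithTop.coe_inj (a := k) (b := n)).symm
  rw [this]
  exact (S.info.le n _ (π.measurableSet_eq n)).union (htop.inter (MeasurableSet.const _))

/-- The mean delay in batches, summed over the batches at which the alarm is overdue. -/
theorem meanSampledDelay_eq (π : S.Policy) :
    π.meanSampledDelay = ∑' n : ℕ, P ({ω | S.K ω ≤ n} ∩ {ω | (n : WithTop ℕ) < π.stopIndex ω}) := by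
  have hmeas : ∀ n : ℕ, MeasurableSet ({ω | S.K ω ≤ n} ∩ {ω | (n : WithTop ℕ) < π.stopIndex ω}) :=
    fun n => (S.measurable_K measurableSet_Iic).inter (S.info.le n _ (π.measurableSet_gt n))
  simp_rw [← lintegral_indicator_one (hmeas _)]
  rw [← lintegral_tsum fun n => (measurable_one.indicator (hmeas n)).aemeasurable,
    meanSampledDelay]
  refine lintegral_congr_ae ?_
  filter_upwards [π.ae_stopIndex_eq] with ω hω
  have h1 : ∀ n : ℕ, n ∉ Finset.Ico (S.K ω) (π.Kt ω) →
      ({ω | S.K ω ≤ n} ∩ {ω | (n : WithTop ℕ) < π.stopIndex ω}).indicator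
        (1 : Ω → ℝ≥0∞) ω = 0 := by
    intro n hn
    refine Set.indicator_of_notMem (fun h => hn ?_) _
    have h2 : (n : WithTop ℕ) < π.stopIndex ω := h.2
    rw [hω] at h2
    exact Finset.mem_Ico.2 ⟨h.1, by exact_mod_cast h2⟩
  rw [tsum_eq_sum h1, Finset.sum_congr rfl (g := fun _ => (1 : ℝ≥0∞))]
  · rw [Finset.sum_const, Nat.card_Ico, nsmul_one, ← ENNReal.ofReal_natCast]
    congr 1
    rcases le_total (S.K ω) (π.Kt ω) with h | h
    · rw [Nat.cast_sub h, sup_eq_left]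
      simpa using h
    · rw [Nat.sub_eq_zero_of_le h, Nat.cast_zero, sup_eq_right]
      simpa using h
  · intro n hn
    rw [Finset.mem_Ico] at hn
    have h2 : (n : WithTop ℕ) < π.stopIndex ω := by
      rw [hω]
      exact_mod_cast hn.2
    have h3 : ω ∈ {ω | S.K ω ≤ n} ∩ {ω | (n : WithTop ℕ) < π.stopIndex ω} := ⟨hn.1, h2⟩
    rw [Set.indicator_of_mem h3, Pi.one_apply]

theorem falseAlarm_eq_tsum (π : S.Policy) :
    π.falseAlarm = ∑' n : ℕ, P ({ω | S.K ω = n + 1} ∩ {ω | π.stopIndex ω ≤ n}) := by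
  have hmeas : ∀ n : ℕ, MeasurableSet ({ω | S.K ω = n + 1} ∩ {ω | π.stopIndex ω ≤ n}) :=
    fun n => (S.measurable_K (measurableSet_singleton _)).inter
      (S.info.le n _ (π.measurableSet_le n))
  rw [← measure_iUnion (fun i j hij => Set.disjoint_left.2 fun ω h h' => hij (by
    have h1 : S.K ω = i + 1 := h.1
    have h2 : S.K ω = j + 1 := h'.1
    omega)) hmeas, falseAlarm_eq]
  refine measure_congr (Filter.eventuallyEq_set.2 ?_)
  filter_upwards [π.ae_stopIndex_eq] with ω hω
  rw [Set.mem_iUnion]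
  constructor
  · intro h
    refine ⟨S.K ω - 1, show S.K ω = _ by omega, ?_⟩
    change π.stopIndex ω ≤ _
    rw [hω]
    exact_mod_cast (by omega : π.Kt ω ≤ S.K ω - 1)
  · rintro ⟨n, h1, h2⟩
    have h1 : S.K ω = n + 1 := h1
    have h2 : π.stopIndex ω ≤ n := h2
    rw [hω] at h2
    have h2 : π.Kt ω ≤ n := by exact_mod_cast h2
    omega

end Policy

theorem SojournStationary.lintegral_sojourn {j : ℕ} {d : ℝ} (h : S.SojournStationary j d) (n : ℕ) :
    ∫⁻ ω, (S.sojourn (j + n) ω : ℝ≥0∞) ∂P = ENNReal.ofReal d := by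
  induction n with
  | zero =>
    rw [← h.2.2, ofReal_integral_eq_lintegral_ofReal h.2.1
      (Filter.Eventually.of_forall fun ω => by positivity)]
    simp
  | succ n ih =>
    have hu : Measurable fun x : ℕ → ℕ => (x n : ℝ≥0∞) :=
      (measurable_from_top (f := fun k : ℕ => (k : ℝ≥0∞))).comp (measurable_pi_apply n)
    have := (h.1.comp hu).lintegral_eq
    simp only [Function.comp_def] at this
    rw [← ih, this]
    rfl

theorem SojournStationary.nonneg {j : ℕ} {d : ℝ} (h : S.SojournStationary j d) : 0 ≤ d := by
  rw [← h.2.2]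
  exact integral_nonneg fun ω => by positivity

theorem lintegral_sojourn_indicator [IsProbabilityMeasure P] (S : Model P F₀ F₁ N r ρ p) (n : ℕ)
    {A : Set Ω} (hA : MeasurableSet[S.observations] A) (k : ℕ) :
    ∫⁻ ω, (S.sojourn n ω : ℝ≥0∞) * ({ω | S.K ω ≤ k} ∩ A).indicator 1 ω ∂P
      = (∫⁻ ω, (S.sojourn n ω : ℝ≥0∞) ∂P) * P ({ω | S.K ω ≤ k} ∩ A) := by
  obtain ⟨B, hB, rfl⟩ := hA
  have hs : Measurable fun x : ℕ → Fin N → ℕ =>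
      ((Finset.univ.sup fun i => x n i : ℕ) : ℝ≥0∞) :=
    (measurable_from_top (f := fun k : ℕ => (k : ℝ≥0∞))).comp (measurable_finset_sup_nat fun i =>
      (measurable_pi_apply i).comp (measurable_pi_apply n))
  have hC : MeasurableSet {z : ℕ × (ℕ → Fin N → 𝒳) × ℝ |
      z.1 ≤ k * S.period ∧ (z.2.2, z.2.1) ∈ B} :=
    (measurable_fst measurableSet_Iic).inter
      ((measurable_snd.snd.prodMk measurable_snd.fst) hB)
  have hset : {ω | S.K ω ≤ k} ∩ (fun ω => (S.V ω, S.path ω)) ⁻¹' B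
      = (fun ω => (S.T ω, (fun (b : ℕ) (i : Fin N) => S.X (b + 1) i ω), S.V ω)) ⁻¹'
        {z | z.1 ≤ k * S.period ∧ (z.2.2, z.2.1) ∈ B} := by
    ext ω
    exact and_congr (S.K_le_iff ω k) Iff.rfl
  rw [hset]
  exact lintegral_mul_indicator_of_indepFun
    (measurable_pi_lambda _ fun b => measurable_pi_lambda _ fun i => S.measurable_delay b i)
    (S.measurable_T.prodMk (S.measurable_path.prodMk S.measurable_V)) S.indep_delay hs hC

namespace Policy

theorem lintegral_sojourn_Kt [IsProbabilityMeasure P] (π : S.Policy) {j : ℕ} {d : ℝ}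
    (hd : S.SojournStationary j d) (hj : ∀ᵐ ω ∂P, j ≤ π.Kt ω) :
    ∫⁻ ω in {ω | S.K ω ≤ π.Kt ω}, (S.sojourn (π.Kt ω) ω : ℝ≥0∞) ∂P
      = ENNReal.ofReal d * P {ω | S.K ω ≤ π.Kt ω} := by
  have hset : ({ω | S.K ω ≤ π.Kt ω} : Set Ω)
      =ᵐ[P] ⋃ n : ℕ, ({ω | S.K ω ≤ n} ∩ {ω | π.stopIndex ω = n}) := by
    refine Filter.eventuallyEq_set.2 ?_
    filter_upwards [π.ae_stopIndex_eq] with ω hω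
    rw [Set.mem_iUnion]
    constructor
    · exact fun h => ⟨π.Kt ω, h, hω⟩
    · rintro ⟨n, h1, h2⟩
      have h2 : π.stopIndex ω = n := h2
      rw [hω] at h2
      have h2 : π.Kt ω = n := by exact_mod_cast h2
      exact h2 ▸ h1
  have hmeas : ∀ n : ℕ, MeasurableSet ({ω | S.K ω ≤ n} ∩ {ω | π.stopIndex ω = n}) := fun n =>
    (S.measurable_K measurableSet_Iic).inter (S.info.le n _ (π.measurableSet_eq n))
  have hdisj : Pairwise (Function.onFun Disjoint fun n : ℕ =>
      ({ω | S.K ω ≤ n} ∩ {ω | π.stopIndex ω = n})) := fun a b hab =>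
    Set.disjoint_left.2 fun ω h h' => hab (by
      have h1 : π.stopIndex ω = a := h.2
      have h2 : π.stopIndex ω = b := h'.2
      exact_mod_cast h1.symm.trans h2)
  rw [setLIntegral_congr hset, measure_congr hset, lintegral_iUnion hmeas hdisj,
    measure_iUnion hdisj hmeas, ← ENNReal.tsum_mul_left]
  refine tsum_congr fun n => ?_
  have h1 : ∫⁻ ω in {ω | S.K ω ≤ n} ∩ {ω | π.stopIndex ω = n},
      (S.sojourn (π.Kt ω) ω : ℝ≥0∞) ∂P
      = ∫⁻ ω, (S.sojourn n ω : ℝ≥0∞) *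
        ({ω | S.K ω ≤ n} ∩ {ω | π.stopIndex ω = n}).indicator 1 ω ∂P := by
    rw [← lintegral_indicator (hmeas n)]
    refine lintegral_congr fun ω => ?_
    by_cases hω : ω ∈ {ω | S.K ω ≤ n} ∩ {ω | π.stopIndex ω = n}
    · have h2 : π.stopIndex ω = n := hω.2
      rw [Set.indicator_of_mem hω, Set.indicator_of_mem hω, Kt, h2,
        Pi.one_apply, mul_one]
      rfl
    · rw [Set.indicator_of_notMem hω, Set.indicator_of_notMem hω, mul_zero]
  rw [h1, S.lintegral_sojourn_indicator n (S.info_le_observations n _ (π.measurableSet_eq n)) n]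
  rcases le_or_gt j n with hn | hn
  · obtain ⟨k, rfl⟩ := Nat.exists_eq_add_of_le hn
    rw [hd.lintegral_sojourn k]
  · have h0 : P ({ω | S.K ω ≤ n} ∩ {ω | π.stopIndex ω = n}) = 0 := by
      refine measure_mono_null Set.inter_subset_right ?_
      have : ∀ᵐ ω ∂P, ¬ π.stopIndex ω = n := by
        filter_upwards [hj, π.ae_stopIndex_eq] with ω h1 h2 h3
        rw [h2] at h3
        have h3 : π.Kt ω = n := by exact_mod_cast h3
        omega
      simpa [ae_iff] using this
    rw [h0, mul_zero, mul_zero]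

theorem lintegral_coarse_Kt [IsProbabilityMeasure P] (hp : 0 < p) (hp' : p ≤ 1) (π : S.Policy) :
    ∫⁻ ω in {ω | S.K ω ≤ π.Kt ω}, ((S.K ω * S.period - S.T ω : ℕ) : ℝ≥0∞) ∂P
      = ENNReal.ofReal (coarseDelay p r) * P {ω | 0 < S.T ω ∧ S.K ω ≤ π.Kt ω} := by
  have h := S.setLIntegral_sub_T hp hp'
    (A := fun κ => {ω | (κ : WithTop ℕ) ≤ π.stopIndex ω})
    fun κ => S.info_le_observations κ _ (π.measurableSet_ge κ)
  have hset : ({ω | 0 < S.T ω ∧ S.K ω ≤ π.Kt ω} : Set Ω) =ᵐ[P]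
      {ω | 0 < S.T ω ∧ ω ∈ {ω' | (S.K ω : WithTop ℕ) ≤ π.stopIndex ω'}} := by
    refine Filter.eventuallyEq_set.2 ?_
    filter_upwards [π.ae_stopIndex_eq] with ω hω
    rw [hω]
    norm_cast
  rw [← measure_congr hset, ← setLIntegral_congr hset] at h
  rw [← h]
  have hm1 : MeasurableSet {ω | S.K ω ≤ π.Kt ω} :=
    _root_.measurableSet_le S.measurable_K π.measurable_Kt
  have hm2 : MeasurableSet {ω | 0 < S.T ω ∧ S.K ω ≤ π.Kt ω} := S.measurableSet_T_pos.inter hm1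
  rw [← lintegral_indicator hm1, ← lintegral_indicator hm2]
  refine lintegral_congr fun ω => ?_
  by_cases h1 : S.K ω ≤ π.Kt ω
  · by_cases h2 : 0 < S.T ω
    · rw [Set.indicator_of_mem (by exact h1), Set.indicator_of_mem (by exact ⟨h2, h1⟩)]
    · rw [Set.indicator_of_mem (by exact h1), Set.indicator_of_notMem (fun h => h2 h.1)]
      have h3 : S.T ω = 0 := by omega
      have h4 := (S.K_eq_zero_iff ω).2 h3
      simp [h3, h4]
  · rw [Set.indicator_of_notMem (by exact h1), Set.indicator_of_notMem (fun h => h1 h.2)]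

theorem meanDetectionDelay_eq_add [IsProbabilityMeasure P] (hp : 0 < p) (hp' : p ≤ 1)
    (π : S.Policy) {j : ℕ} {d : ℝ} (hd : S.SojournStationary j d)
    (hj : ∀ᵐ ω ∂P, j ≤ π.Kt ω) :
    π.meanDetectionDelay = ENNReal.ofReal d * P {ω | S.K ω ≤ π.Kt ω}
      + ENNReal.ofReal (coarseDelay p r) * P {ω | 0 < S.T ω ∧ S.K ω ≤ π.Kt ω}
      + ENNReal.ofReal (1 / r) * π.meanSampledDelay := by
  have hm : MeasurableSet {ω | S.K ω ≤ π.Kt ω} :=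
    _root_.measurableSet_le S.measurable_K π.measurable_Kt
  have hmc : Measurable fun ω => ((S.K ω * S.period - S.T ω : ℕ) : ℝ≥0∞) :=
    (measurable_from_top (f := fun n : ℕ => (n : ℝ≥0∞))).comp
      ((S.measurable_K.mul_const _).sub S.measurable_T)
  have hmd : Measurable fun ω => ENNReal.ofReal (((π.Kt ω : ℝ) - (S.K ω : ℝ)) ⊔ 0) :=
    ENNReal.measurable_ofReal.comp
      ((((measurable_from_top (f := fun n : ℕ => (n : ℝ))).comp π.measurable_Kt).sub
        ((measurable_from_top (f := fun n : ℕ => (n : ℝ))).comp S.measurable_K)).sup_const 0)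
  rw [← π.lintegral_sojourn_Kt hd hj, ← π.lintegral_coarse_Kt hp hp', meanSampledDelay,
    ← lintegral_const_mul _ hmd, ← lintegral_indicator hm, ← lintegral_indicator hm,
    ← lintegral_add_right _ (hmc.indicator hm), ← lintegral_add_right _ (hmd.const_mul _),
    meanDetectionDelay]
  refine lintegral_congr fun ω => ?_
  by_cases h : S.K ω ≤ π.Kt ω
  · rw [Set.indicator_of_mem (by exact (π.T_le_Tt_iff ω).2 h), Set.indicator_of_mem (by exact h),
      Set.indicator_of_mem (by exact h), ← ENNReal.ofReal_natCast, ← ENNReal.ofReal_natCast,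
      ← ENNReal.ofReal_mul (one_div_pos.2 S.rate_pos).le,
      ← ENNReal.ofReal_add (by positivity) (by positivity),
      ← ENNReal.ofReal_add (by positivity)
        (mul_nonneg (one_div_pos.2 S.rate_pos).le le_sup_right)]
    congr 1
    have h' : (S.K ω : ℝ) ≤ π.Kt ω := by exact_mod_cast h
    rw [sup_eq_left.2 (by linarith), Ut, arrival, samplingTime, Nat.cast_sub (S.T_le_K_mul ω),
      ← S.period_eq]
    push_cast
    ring
  · have h' : ¬ (S.T ω ≤ π.Tt ω) := fun h2 => h ((π.T_le_Tt_iff ω).1 h2)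
    have h'' : (π.Kt ω : ℝ) ≤ S.K ω := by exact_mod_cast (not_le.1 h).le
    rw [Set.indicator_of_notMem (by exact h'), Set.indicator_of_notMem (by exact h),
      Set.indicator_of_notMem (by exact h), sup_eq_right.2 (by linarith)]
    simp

/-- Decomposition of the mean detection delay into network delay, coarse-sampling delay and the
decision maker's delay. -/
theorem meanDetectionDelay_eq [IsProbabilityMeasure P] (hρ : 0 ≤ ρ) (hp : 0 < p) (hp' : p ≤ 1)
    (π : S.Policy) {j : ℕ} {d a : ℝ} (hd : S.SojournStationary j d)
    (hj : ∀ᵐ ω ∂P, j ≤ π.Kt ω) (ha : 0 ≤ a) (ha' : a ≤ 1 - ρ)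
    (hfa : π.falseAlarm = ENNReal.ofReal a) :
    π.meanDetectionDelay =
      ENNReal.ofReal ((d + coarseDelay p r) * (1 - a) - ρ * coarseDelay p r)
      + ENNReal.ofReal (1 / r) * π.meanSampledDelay := by
  have hm : MeasurableSet {ω | S.K ω ≤ π.Kt ω} :=
    _root_.measurableSet_le S.measurable_K π.measurable_Kt
  have hc : {ω | S.K ω ≤ π.Kt ω} = {ω | π.Kt ω < S.K ω}ᶜ := by ext ω; simp
  have h1 : P {ω | S.K ω ≤ π.Kt ω} = ENNReal.ofReal (1 - a) := by
    rw [hc, prob_compl_eq_one_sub (measurableSet_lt π.measurable_Kt S.measurable_K),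
      ← π.falseAlarm_eq, hfa, ENNReal.ofReal_sub _ ha, ENNReal.ofReal_one]
  have h2 : P {ω | 0 < S.T ω ∧ S.K ω ≤ π.Kt ω} = ENNReal.ofReal (1 - a - ρ) := by
    have hset : {ω | 0 < S.T ω ∧ S.K ω ≤ π.Kt ω} = {ω | S.K ω ≤ π.Kt ω} \ S.T ⁻¹' {0} := by
      ext ω
      simp [Nat.pos_iff_ne_zero, and_comm]
    rw [hset, measure_sdiff _ (S.measurable_T (measurableSet_singleton 0)).nullMeasurableSet
      (measure_ne_top _ _), h1, S.prob_T_zero, ENNReal.ofReal_sub _ hρ]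
    intro ω hω
    have : S.K ω = 0 := (S.K_eq_zero_iff ω).2 hω
    simp [this]
  have hl := S.coarseDelay_nonneg hp hp'
  rw [π.meanDetectionDelay_eq_add hp hp' hd hj, h1, h2, ← ENNReal.ofReal_mul hd.nonneg,
    ← ENNReal.ofReal_mul hl, ← ENNReal.ofReal_add (mul_nonneg hd.nonneg (by linarith))
      (mul_nonneg hl (by linarith))]
  congr 2
  ring

end Policy
end Model
end NODM

namespace NODM

theorem volume_restrict_ofReal_le {c : ℝ≥0∞} (hc : c ≤ 1) :
    (volume.restrict (Set.Icc (0 : ℝ) 1)) {v : ℝ | ENNReal.ofReal v ≤ c} = c := by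
  have hc' : c ≠ ∞ := ne_top_of_le_ne_top ENNReal.one_ne_top hc
  have hc1 : c.toReal ≤ 1 := ENNReal.toReal_mono ENNReal.one_ne_top hc
  have hset : {v : ℝ | ENNReal.ofReal v ≤ c} ∩ Set.Icc (0 : ℝ) 1 = Set.Icc 0 c.toReal := by
    ext v
    simp only [Set.mem_inter_iff, Set.mem_ofPred_eq, Set.mem_Icc,
      ENNReal.ofReal_le_iff_le_toReal hc']
    constructor
    · rintro ⟨h1, h2, h3⟩; exact ⟨h2, h1⟩
    · rintro ⟨h1, h2⟩; exact ⟨h2, h1, h2.trans hc1⟩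
  rw [Measure.restrict_apply (measurableSet_le ENNReal.measurable_ofReal measurable_const), hset,
    Real.volume_Icc, sub_zero, ENNReal.ofReal_toReal hc']

namespace Model

variable {Ω 𝒳 : Type*} [MeasurableSpace Ω] [MeasurableSpace 𝒳] {P : Measure Ω}
  {F₀ F₁ : Measure 𝒳} {N : ℕ} {r ρ p : ℝ} (S : Model P F₀ F₁ N r ρ p)

theorem measurable_V_info (n : ℕ) : Measurable[S.info n] S.V :=
  (comap_measurable S.V).mono le_sup_left le_rfl

theorem measurable_X_info {k n : ℕ} (hk : 1 ≤ k) (hkn : k ≤ n) (i : Fin N) :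
    Measurable[S.info n] (S.X k i) := by
  refine (comap_measurable (S.X k i)).mono (le_trans ?_ le_sup_right) le_rfl
  exact le_iSup₂_of_le k (Finset.mem_Icc.2 ⟨hk, hkn⟩)
    (le_iSup (fun i => MeasurableSpace.comap (S.X k i) inferInstance) i)

/-- A function of the information after `n` batches is a function of the randomization and of
the first `n` batches. -/
theorem exists_eq_comp_of_measurable_info {n : ℕ} {f : Ω → ℝ≥0∞} (hf : Measurable[S.info n] f) :
    ∃ h : ℝ × (Fin n → Fin N → 𝒳) → ℝ≥0∞, Measurable h ∧
      ∀ ω, f ω = h (S.V ω, fun k => S.path ω k) := by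
  let Z : Ω → ℝ × (Fin n → Fin N → 𝒳) := fun ω => (S.V ω, fun k => S.path ω k)
  have hle : S.info n ≤ MeasurableSpace.comap Z inferInstance := by
    have h : Measurable[MeasurableSpace.comap Z inferInstance] Z := comap_measurable _
    refine sup_le (measurable_fst.comp h).comap_le (iSup₂_le fun k hk => iSup_le fun i => ?_)
    obtain ⟨hk1, hk2⟩ := Finset.mem_Icc.1 hk
    obtain ⟨b, rfl⟩ : ∃ b, k = b + 1 := ⟨k - 1, by omega⟩
    exact Measurable.comap_le ((measurable_pi_apply i).comp
      ((measurable_pi_apply (⟨b, by omega⟩ : Fin n)).comp (measurable_snd.comp h)))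
  obtain ⟨h, hh, hfh⟩ := (hf.mono hle le_rfl).exists_eq_measurable_comp
  exact ⟨h, hh, fun ω => congrFun hfh ω⟩

/-- The randomization uniform on `[0, 1]` suffices to implement any process of continuation
probabilities, even one that itself depends on the randomization. -/
theorem exists_continuation_sets [IsProbabilityMeasure P] (B : ℕ → Ω → ℝ≥0∞)
    (hB : ∀ n, Measurable[S.info n] (B n)) (hB1 : ∀ n ω, B n ω ≤ 1)
    (hanti : ∀ ω, Antitone fun n => B n ω) :
    ∃ E : ℕ → Set Ω, (∀ n, MeasurableSet[S.info n] (E n)) ∧ Antitone E ∧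
      ∀ n (G : Set ℕ), P (S.T ⁻¹' G ∩ E n) = ∫⁻ ω in S.T ⁻¹' G, B n ω ∂P := by
  choose f hf hBf using fun n => S.exists_eq_comp_of_measurable_info (hB n)
  let ν : Measure ℝ := volume.restrict (Set.Icc (0 : ℝ) 1)
  have hν : ν Set.univ = 1 := by simp [ν]
  let g : ℕ → ℝ × (ℕ → Fin N → 𝒳) → ℝ≥0∞ :=
    fun n z => 1 ⊓ ⨅ k : Fin (n + 1), f k (z.1, fun i => z.2 i)
  have hg : ∀ n, Measurable (g n) := fun n =>
    measurable_const.min (Measurable.iInf fun k => (hf k).comp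
      (measurable_fst.prodMk (measurable_pi_lambda _ fun i =>
        (measurable_pi_apply _).comp measurable_snd)))
  have hganti : ∀ z, Antitone fun n => g n z := fun z a b hab => by
    refine inf_le_inf le_rfl (le_iInf fun k => ?_)
    exact iInf_le_of_le (⟨k, by omega⟩ : Fin (b + 1)) le_rfl
  have hgB : ∀ n ω, g n (S.V ω, S.path ω) = B n ω := by
    intro n ω
    refine le_antisymm ?_ (le_inf (hB1 n ω) (le_iInf fun k => ?_))
    · refine inf_le_right.trans ((iInf_le _ (Fin.last n)).trans ?_)
      rw [hBf n ω]
      exact le_rfl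
    · rw [← hBf k ω]
      exact hanti ω (by omega)
  let ψ : ℕ → (ℕ → Fin N → 𝒳) → ℝ≥0∞ := fun n x => ∫⁻ v, g n (v, x) ∂ν
  have hψ : ∀ n, Measurable (ψ n) := fun n => (hg n).lintegral_prod_left'
  have hψ1 : ∀ n x, ψ n x ≤ 1 := fun n x => by
    calc ψ n x ≤ ∫⁻ _, 1 ∂ν := lintegral_mono fun v => inf_le_left
      _ = 1 := by rw [lintegral_one, hν]
  have hψanti : ∀ x, Antitone fun n => ψ n x := fun x a b hab =>
    lintegral_mono fun v => hganti (v, x) hab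
  have hψinfo : ∀ n, Measurable[S.info n] fun ω => ψ n (S.path ω) := by
    intro n
    have hX : ∀ k : Fin (n + 1), Measurable[S.info n]
        fun ω (i : Fin (k : ℕ)) => S.path ω i := fun k =>
      @measurable_pi_lambda _ _ _ (S.info n) _ _ fun i =>
        @measurable_pi_lambda _ _ _ (S.info n) _ _ fun l =>
          S.measurable_X_info (Nat.le_add_left 1 _) (by omega) l
    have hjoint : @Measurable _ _ (@Prod.instMeasurableSpace ℝ Ω _ (S.info n)) _
        fun z : ℝ × Ω => g n (z.1, S.path z.2) := by
      let : MeasurableSpace Ω := S.info n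
      exact measurable_const.min (Measurable.iInf fun k => (hf k).comp
        (measurable_fst.prodMk ((hX k).comp measurable_snd)))
    exact @Measurable.lintegral_prod_left' ℝ Ω _ (S.info n) ν _ _ hjoint
  refine ⟨fun n => {ω | ENNReal.ofReal (S.V ω) ≤ ψ n (S.path ω)}, fun n => ?_, ?_, ?_⟩
  · exact measurableSet_le (mδ := S.info n)
      (ENNReal.measurable_ofReal.comp (S.measurable_V_info n)) (hψinfo n)
  · intro a b hab ω hω
    exact le_trans (show ENNReal.ofReal (S.V ω) ≤ ψ b (S.path ω) from hω)
      (hψanti (S.path ω) hab)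
  · intro n G
    have hG : MeasurableSet (S.T ⁻¹' G) := S.measurable_T (MeasurableSet.of_discrete)
    have key : ∀ H : ℝ × (ℕ → Fin N → 𝒳) → ℝ≥0∞, Measurable H →
        ∫⁻ ω in S.T ⁻¹' G, H (S.V ω, S.path ω) ∂P
          = ∫⁻ ω in S.T ⁻¹' G, ∫⁻ v, H (v, S.path ω) ∂ν ∂P := by
      intro H hH
      have hH' : Measurable fun z : ℝ × (ℕ × (ℕ → Fin N → 𝒳)) =>
          G.indicator 1 z.2.1 * H (z.1, z.2.2) :=
        ((measurable_from_top (f := G.indicator (1 : ℕ → ℝ≥0∞))).comp measurable_snd.fst).mul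
          (hH.comp (measurable_fst.prodMk measurable_snd.snd))
      have e := lintegral_comp_prodMk_of_indepFun S.measurable_V
        (S.measurable_T.prodMk S.measurable_path) S.indep_V hH'
      rw [S.law_V] at e
      rw [← lintegral_indicator hG, ← lintegral_indicator hG]
      convert e using 1
      · refine lintegral_congr fun ω => ?_
        by_cases h : S.T ω ∈ G <;> simp [h]
      · refine lintegral_congr fun ω => ?_
        by_cases h : S.T ω ∈ G <;> simp [h, ν]
    have h1 := key (g n) (hg n)
    have hset : MeasurableSet {z : ℝ × (ℕ → Fin N → 𝒳) | ENNReal.ofReal z.1 ≤ ψ n z.2} :=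
      measurableSet_le (ENNReal.measurable_ofReal.comp measurable_fst)
        ((hψ n).comp measurable_snd)
    have h2 := key ({z | ENNReal.ofReal z.1 ≤ ψ n z.2}.indicator 1) (measurable_one.indicator hset)
    simp_rw [hgB] at h1
    rw [h1]
    have h3 : ∀ ω, ∫⁻ v, {z : ℝ × (ℕ → Fin N → 𝒳) | ENNReal.ofReal z.1 ≤ ψ n z.2}.indicator
        (1 : ℝ × (ℕ → Fin N → 𝒳) → ℝ≥0∞) (v, S.path ω) ∂ν = ψ n (S.path ω) := by
      intro ω
      rw [← volume_restrict_ofReal_le (hψ1 n (S.path ω)), ← lintegral_indicator_one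
        (measurableSet_le ENNReal.measurable_ofReal measurable_const)]
      rfl
    simp_rw [h3] at h2
    rw [← h2, Set.inter_comm, ← Measure.restrict_apply' hG, ← lintegral_indicator_one]
    · rfl
    · exact (S.measurable_V.prodMk S.measurable_path) hset

open scoped Classical in
/-- The first time a decreasing sequence of continuation sets is left. -/
noncomputable def exitIndex {Ω : Type*} (E : ℕ → Set Ω) (ω : Ω) : WithTop ℕ :=
  if h : ∃ n, ω ∉ E n then ((Nat.find h : ℕ) : WithTop ℕ) else ⊤

theorem lt_exitIndex_iff {Ω : Type*} {E : ℕ → Set Ω} (hE : Antitone E) (ω : Ω) (n : ℕ) :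
    (n : WithTop ℕ) < exitIndex E ω ↔ ω ∈ E n := by
  classical
  by_cases h : ∃ n, ω ∉ E n
  · rw [exitIndex, dif_pos h, Nat.cast_lt, Nat.lt_find_iff]
    simp only [not_not]
    exact ⟨fun h => h n le_rfl, fun h m hm => hE hm h⟩
  · rw [exitIndex, dif_neg h]
    push Not at h
    exact ⟨fun _ => h n, fun _ => WithTop.coe_lt_top n⟩

theorem isStoppingTime_exitIndex {E : ℕ → Set Ω} (hE : Antitone E)
    (hm : ∀ n, MeasurableSet[S.info n] (E n)) : IsStoppingTime S.info (exitIndex E) := by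
  intro n
  have : {ω | exitIndex E ω ≤ n} = (E n)ᶜ := by
    ext ω
    exact not_lt.symm.trans (lt_exitIndex_iff hE ω n).not
  exact (show MeasurableSet[S.info n] {ω | exitIndex E ω ≤ (n : WithTop ℕ)} from
    this ▸ (hm n).compl)

end Model
end NODM

namespace NODM

/-- The total mass that a process of nonnegative functions `B n` puts on a sequence of sets. -/
noncomputable def massOn {Ω : Type*} [MeasurableSpace Ω] (P : Measure Ω) (s : ℕ → Set Ω)
    (B : ℕ → Ω → ℝ) : ℝ≥0∞ :=
  ∑' n, ∫⁻ ω in s n, ENNReal.ofReal (B n ω) ∂P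

theorem massOn_midpoint_le {Ω : Type*} [MeasurableSpace Ω] {P : Measure Ω} {s : ℕ → Set Ω}
    {B B' : ℕ → Ω → ℝ} {c : ℝ≥0∞} (hB : ∀ n, Measurable (B n)) (h0 : ∀ n ω, 0 ≤ B n ω)
    (h0' : ∀ n ω, 0 ≤ B' n ω) (h : massOn P s B ≤ c) (h' : massOn P s B' ≤ c) :
    massOn P s (fun n ω => (B n ω + B' n ω) / 2) ≤ c := by
  have e : massOn P s (fun n ω => (B n ω + B' n ω) / 2)
      = 2⁻¹ * (massOn P s B + massOn P s B') := by
    rw [massOn, massOn, massOn, ← ENNReal.tsum_add, ← ENNReal.tsum_mul_left]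
    refine tsum_congr fun n => ?_
    have hm : Measurable fun ω => ENNReal.ofReal (B n ω) := ENNReal.measurable_ofReal.comp (hB n)
    rw [← lintegral_add_left hm,
      ← lintegral_const_mul' _ _ (by simp)]
    refine lintegral_congr fun ω => ?_
    rw [← ENNReal.ofReal_add (h0 n ω) (h0' n ω), div_eq_inv_mul,
      ENNReal.ofReal_mul (by norm_num), ENNReal.ofReal_inv_of_pos (by norm_num)]
    simp
  rw [e]
  calc 2⁻¹ * (massOn P s B + massOn P s B') ≤ 2⁻¹ * (c + c) := by gcongr
    _ = c := by rw [← two_mul, ← mul_assoc, ENNReal.inv_mul_cancel (by simp) (by simp), one_mul]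

open Filter Topology in
theorem massOn_le_liminf {Ω : Type*} [MeasurableSpace Ω] {P : Measure Ω} {s : ℕ → Set Ω}
    {B : ℕ → Ω → ℝ} {b : ℕ → ℕ → Ω → ℝ} (hb : ∀ k n, Measurable (b k n))
    (hlim : ∀ n, ∀ᵐ ω ∂P, Tendsto (fun k => b k n ω) atTop (𝓝 (B n ω))) :
    massOn P s B ≤ liminf (fun k => massOn P s (b k)) atTop := by
  have h1 : ∀ n, ∫⁻ ω in s n, ENNReal.ofReal (B n ω) ∂P
      ≤ liminf (fun k => ∫⁻ ω in s n, ENNReal.ofReal (b k n ω) ∂P) atTop := by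
    intro n
    refine le_trans (le_of_eq (lintegral_congr_ae ?_))
      (lintegral_liminf_le fun k => ENNReal.measurable_ofReal.comp (hb k n))
    filter_upwards [ae_restrict_of_ae (hlim n)] with ω hω
    exact ((ENNReal.continuous_ofReal.tendsto _).comp hω).liminf_eq.symm
  calc massOn P s B
      ≤ ∑' n, liminf (fun k => ∫⁻ ω in s n, ENNReal.ofReal (b k n ω) ∂P) atTop :=
        ENNReal.tsum_le_tsum h1
    _ = ∫⁻ n, liminf (fun k => ∫⁻ ω in s n, ENNReal.ofReal (b k n ω) ∂P) atTop
          ∂(Measure.count : Measure ℕ) := (lintegral_count _).symm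
    _ ≤ liminf (fun k => ∫⁻ n, ∫⁻ ω in s n, ENNReal.ofReal (b k n ω) ∂P
          ∂(Measure.count : Measure ℕ)) atTop := lintegral_liminf_le fun k => measurable_from_top
    _ = liminf (fun k => massOn P s (b k)) atTop := by simp_rw [lintegral_count]; rfl

namespace Model

variable {Ω 𝒳 : Type*} [MeasurableSpace Ω] [MeasurableSpace 𝒳] {P : Measure Ω}
  {F₀ F₁ : Measure 𝒳} {N : ℕ} {r ρ p : ℝ} (S : Model P F₀ F₁ N r ρ p)

/-- A relaxed policy: `B n` is the probability of continuing after batch `n`, given the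
information then available. The policy never stops before batch `j`. -/
structure IsSurvival (j : ℕ) (B : ℕ → Ω → ℝ) : Prop where
  adapted : ∀ n, Measurable[S.info n] (B n)
  mem_Icc : ∀ n ω, B n ω ∈ Set.Icc (0 : ℝ) 1
  antitone : ∀ ω, Antitone fun n => B n ω
  eq_one : ∀ n < j, ∀ᵐ ω ∂P, B n ω = 1

/-- The mean delay in batches of a relaxed policy. -/
noncomputable def survivalDelay (B : ℕ → Ω → ℝ) : ℝ≥0∞ :=
  massOn P (fun n => {ω | S.K ω ≤ n}) B

/-- The probability of false alarm of a relaxed policy. -/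
noncomputable def survivalAlarm (B : ℕ → Ω → ℝ) : ℝ≥0∞ :=
  massOn P (fun n => {ω | S.K ω = n + 1}) fun n ω => 1 - B n ω

variable {S}

theorem IsSurvival.measurable {j : ℕ} {B : ℕ → Ω → ℝ} (h : S.IsSurvival j B) (n : ℕ) :
    Measurable (B n) := (h.adapted n).mono (S.info.le n) le_rfl

theorem IsSurvival.midpoint {j : ℕ} {B B' : ℕ → Ω → ℝ} (h : S.IsSurvival j B)
    (h' : S.IsSurvival j B') : S.IsSurvival j fun n ω => (B n ω + B' n ω) / 2 where
  adapted n := ((h.adapted n).add (h'.adapted n)).div_const 2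
  mem_Icc n ω := by
    have h1 := h.mem_Icc n ω
    have h2 := h'.mem_Icc n ω
    exact ⟨by linarith [h1.1, h2.1], by linarith [h1.2, h2.2]⟩
  antitone ω a b hab := by
    have h1 := h.antitone ω hab
    have h2 := h'.antitone ω hab
    simp only at h1 h2 ⊢
    linarith
  eq_one n hn := by
    filter_upwards [h.eq_one n hn, h'.eq_one n hn] with ω h1 h2
    rw [h1, h2]; norm_num

theorem IsSurvival.survivalDelay_midpoint_le {j : ℕ} {B B' : ℕ → Ω → ℝ} (h : S.IsSurvival j B)
    (h' : S.IsSurvival j B') {c : ℝ≥0∞} (hc : S.survivalDelay B ≤ c)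
    (hc' : S.survivalDelay B' ≤ c) :
    S.survivalDelay (fun n ω => (B n ω + B' n ω) / 2) ≤ c :=
  massOn_midpoint_le h.measurable (fun n ω => (h.mem_Icc n ω).1) (fun n ω => (h'.mem_Icc n ω).1)
    hc hc'

theorem IsSurvival.survivalAlarm_midpoint_le {j : ℕ} {B B' : ℕ → Ω → ℝ} (h : S.IsSurvival j B)
    (h' : S.IsSurvival j B') {c : ℝ≥0∞} (hc : S.survivalAlarm B ≤ c)
    (hc' : S.survivalAlarm B' ≤ c) :
    S.survivalAlarm (fun n ω => (B n ω + B' n ω) / 2) ≤ c := by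
  have := massOn_midpoint_le (fun n => (h.measurable n).const_sub 1)
    (fun n ω => sub_nonneg.2 (h.mem_Icc n ω).2) (fun n ω => sub_nonneg.2 (h'.mem_Icc n ω).2) hc hc'
  have e : ∀ x y : ℝ, 1 - (x + y) / 2 = ((1 - x) + (1 - y)) / 2 := fun x y => by ring
  simp_rw [survivalAlarm, e]
  exact this

open Filter Topology in
/-- Among the relaxed policies subject to a false alarm constraint there is one of least mean
delay. -/
theorem exists_optimal_survival [IsProbabilityMeasure P] (S : Model P F₀ F₁ N r ρ p) (j : ℕ)
    (a : ℝ≥0∞)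
    (hex : ∃ B, S.IsSurvival j B ∧ S.survivalAlarm B ≤ a ∧ S.survivalDelay B ≠ ∞) :
    ∃ B, S.IsSurvival j B ∧ S.survivalAlarm B ≤ a ∧
      ∀ B', S.IsSurvival j B' → S.survivalAlarm B' ≤ a →
        S.survivalDelay B ≤ S.survivalDelay B' := by
  set c : ℝ≥0∞ := sInf (S.survivalDelay '' {B | S.IsSurvival j B ∧ S.survivalAlarm B ≤ a}) with hc
  have hcle : ∀ B', S.IsSurvival j B' → S.survivalAlarm B' ≤ a → c ≤ S.survivalDelay B' :=
    fun B' h1 h2 => sInf_le ⟨B', ⟨h1, h2⟩, rfl⟩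
  have hctop : c ≠ ∞ := by
    obtain ⟨B, h1, h2, h3⟩ := hex
    exact ne_top_of_le_ne_top h3 (hcle B h1 h2)
  let ε : ℕ → ℝ≥0∞ := fun k => ((k : ℝ≥0∞) + 1)⁻¹
  have hε : Antitone ε := fun a b hab => by
    simp only [ε]; gcongr
  let C : ℕ → Set (Ω × ℕ → ℝ) := fun k => {g | S.IsSurvival j (fun n ω => g (ω, n)) ∧
    S.survivalAlarm (fun n ω => g (ω, n)) ≤ a ∧ S.survivalDelay (fun n ω => g (ω, n)) ≤ c + ε k}
  obtain ⟨g, hgC, hglim⟩ := exists_seq_mem_ae_tendsto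
    (P.prod (Measure.count : Measure ℕ).toFinite) C
    (fun k l hkl g hg => ⟨hg.1, hg.2.1, hg.2.2.trans (by gcongr; exact hε hkl)⟩)
    (fun k => by
      obtain ⟨_, ⟨B, hB, rfl⟩, hlt⟩ := sInf_lt_iff.1
        (show sInf (S.survivalDelay '' {B | S.IsSurvival j B ∧ S.survivalAlarm B ≤ a}) < c + ε k
          from ENNReal.lt_add_right hctop (by simp [ε]))
      exact ⟨fun z => B z.2 z.1, hB.1, hB.2, hlt.le⟩)
    (fun g hg => measurable_from_prod_countable_left fun n => hg.1.measurable n)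
    (fun g hg x => hg.1.mem_Icc x.2 x.1)
    (fun k g hg h hh => ⟨hg.1.midpoint hh.1, hg.1.survivalAlarm_midpoint_le hh.1 hg.2.1 hh.2.1,
      hg.1.survivalDelay_midpoint_le hh.1 hg.2.2 hh.2.2⟩)
  have hconv : ∀ᵐ ω ∂P, ∀ n, ∃ l, Tendsto (fun k => g k (ω, n)) atTop (𝓝 l) := by
    filter_upwards [Measure.ae_ae_of_ae_prod hglim] with ω hω
    rw [ae_toFinite] at hω
    exact Measure.ae_count_iff.1 hω
  let B : ℕ → Ω → ℝ := fun n ω =>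
    (limsup (fun k => ENNReal.ofReal (g k (ω, n))) atTop).toReal
  have hle1 : ∀ n ω, limsup (fun k => ENNReal.ofReal (g k (ω, n))) atTop ≤ 1 := fun n ω =>
    limsup_le_of_le (by isBoundedDefault) (Eventually.of_forall fun k => by
      simpa using ((hgC k).1.mem_Icc n ω).2)
  have hBlim : ∀ᵐ ω ∂P, ∀ n, Tendsto (fun k => g k (ω, n)) atTop (𝓝 (B n ω)) := by
    filter_upwards [hconv] with ω hω n
    obtain ⟨l, hl⟩ := hω n
    have h0 : 0 ≤ l := ge_of_tendsto' hl fun k => ((hgC k).1.mem_Icc n ω).1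
    have : B n ω = l := by
      have h1 : limsup (fun k => ENNReal.ofReal (g k (ω, n))) atTop = ENNReal.ofReal l :=
        ((ENNReal.continuous_ofReal.tendsto _).comp hl).limsup_eq
      simp only [B]
      rw [h1, ENNReal.toReal_ofReal h0]
    rwa [this]
  have hBsurv : S.IsSurvival j B := by
    refine ⟨fun n => ?_, fun n ω => ?_, fun ω a b hab => ?_, fun n hn => ?_⟩
    · exact ENNReal.measurable_toReal.comp (Measurable.limsup fun k =>
        ENNReal.measurable_ofReal.comp ((hgC k).1.adapted n))
    · exact ⟨ENNReal.toReal_nonneg, ENNReal.toReal_mono ENNReal.one_ne_top (hle1 n ω)⟩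
    · exact ENNReal.toReal_mono (ne_top_of_le_ne_top ENNReal.one_ne_top (hle1 a ω))
        (limsup_le_limsup (Eventually.of_forall fun k =>
          ENNReal.ofReal_le_ofReal ((hgC k).1.antitone ω hab)))
    · have h1 : ∀ᵐ ω ∂P, ∀ k, g k (ω, n) = 1 := ae_all_iff.2 fun k => (hgC k).1.eq_one n hn
      filter_upwards [h1, hBlim] with ω h1 h2
      have h3 := h2 n
      simp only [h1] at h3
      exact tendsto_nhds_unique h3 tendsto_const_nhds
  refine ⟨B, hBsurv, ?_, fun B' h1 h2 => le_trans ?_ (hcle B' h1 h2)⟩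
  · refine (massOn_le_liminf (b := fun k n ω => 1 - g k (ω, n))
      (fun k n => ((hgC k).1.measurable n).const_sub 1)
      (fun n => hBlim.mono fun ω h => (h n).const_sub 1)).trans ?_
    exact liminf_le_of_frequently_le' (Frequently.of_forall fun k => (hgC k).2.1)
  · refine (massOn_le_liminf (b := fun k n ω => g k (ω, n)) (fun k n => (hgC k).1.measurable n)
      (fun n => hBlim.mono fun ω h => h n)).trans ?_
    have hlim : Tendsto (fun k => c + ε k) atTop (𝓝 c) := by
      have h1 : Tendsto ε atTop (𝓝 0) := by
        have := (tendsto_add_atTop_iff_nat 1).2 ENNReal.tendsto_inv_nat_nhds_zero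
        simpa [ε] using this
      simpa using tendsto_const_nhds.add h1
    rw [← hlim.liminf_eq]
    exact liminf_le_liminf (Eventually.of_forall fun k => (hgC k).2.2)

end Model
end NODM

namespace NODM
namespace Model

variable {Ω 𝒳 : Type*} [MeasurableSpace Ω] [MeasurableSpace 𝒳] {P : Measure Ω}
  {F₀ F₁ : Measure 𝒳} {N : ℕ} {r ρ p : ℝ} {S : Model P F₀ F₁ N r ρ p}

namespace Policy

/-- The survival process of a policy: the indicator of not having stopped. -/
noncomputable def survival (π : S.Policy) (n : ℕ) : Ω → ℝ :=
  {ω | (n : WithTop ℕ) < π.stopIndex ω}.indicator 1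

theorem isSurvival (π : S.Policy) {j : ℕ} (hj : ∀ᵐ ω ∂P, j ≤ π.Kt ω) :
    S.IsSurvival j π.survival where
  adapted n := measurable_const.indicator (π.measurableSet_gt n)
  mem_Icc n ω := by
    by_cases h : (n : WithTop ℕ) < π.stopIndex ω <;> simp [survival, h]
  antitone ω a b hab := by
    refine Set.indicator_le_indicator_of_subset (fun ω h => ?_) (fun _ => zero_le_one) ω
    exact lt_of_le_of_lt (by exact_mod_cast hab) (show (b : WithTop ℕ) < π.stopIndex ω from h)
  eq_one n hn := by
    filter_upwards [hj, π.ae_stopIndex_eq] with ω h1 h2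
    have h3 : (n : WithTop ℕ) < π.stopIndex ω := by
      rw [h2]; exact_mod_cast hn.trans_le h1
    simp [survival, h3]

theorem survivalDelay_survival (π : S.Policy) :
    S.survivalDelay π.survival = π.meanSampledDelay := by
  rw [π.meanSampledDelay_eq, survivalDelay, massOn]
  refine tsum_congr fun n => ?_
  have hm := S.info.le n _ (π.measurableSet_gt n)
  rw [Set.inter_comm, ← Measure.restrict_apply hm, ← lintegral_indicator_one hm]
  refine lintegral_congr fun ω => ?_
  by_cases h : (n : WithTop ℕ) < π.stopIndex ω <;> simp [survival, h]

theorem survivalAlarm_survival (π : S.Policy) :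
    S.survivalAlarm π.survival = π.falseAlarm := by
  rw [π.falseAlarm_eq_tsum, survivalAlarm, massOn]
  refine tsum_congr fun n => ?_
  have hm := S.info.le n _ (π.measurableSet_le n)
  rw [Set.inter_comm, ← Measure.restrict_apply hm, ← lintegral_indicator_one hm]
  refine lintegral_congr fun ω => ?_
  by_cases h : (n : WithTop ℕ) < π.stopIndex ω
  · simp [survival, h]
  · simp [survival, h, not_lt.1 h]

/-- The policy that stops at a fixed batch. -/
def const (S : Model P F₀ F₁ N r ρ p) (n : ℕ) : S.Policy where
  stopIndex := fun _ => n
  isStoppingTime := isStoppingTime_const _ n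
  finite := Filter.Eventually.of_forall fun _ => WithTop.coe_ne_top

theorem const_Kt (n : ℕ) (ω : Ω) : (const S n).Kt ω = n := rfl

end Policy

theorem setLIntegral_ofReal_one_sub [IsProbabilityMeasure P] {B : Ω → ℝ} (hB : Measurable B)
    (hB1 : ∀ ω, B ω ∈ Set.Icc (0 : ℝ) 1) (s : Set Ω) :
    ∫⁻ ω in s, ENNReal.ofReal (1 - B ω) ∂P + ∫⁻ ω in s, ENNReal.ofReal (B ω) ∂P = P s := by
  have hm : Measurable fun ω => ENNReal.ofReal (B ω) := ENNReal.measurable_ofReal.comp hB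
  rw [← lintegral_add_right _ hm, ← setLIntegral_one]
  refine lintegral_congr fun ω => ?_
  rw [← ENNReal.ofReal_add (sub_nonneg.2 (hB1 ω).2) (hB1 ω).1]
  simp

theorem IsSurvival.exists_policy [IsProbabilityMeasure P] {j : ℕ} {B : ℕ → Ω → ℝ}
    (h : S.IsSurvival j B) (hfin : S.survivalDelay B ≠ ∞) :
    ∃ π : S.Policy, (∀ᵐ ω ∂P, j ≤ π.Kt ω) ∧ π.meanSampledDelay = S.survivalDelay B ∧
      π.falseAlarm = S.survivalAlarm B := by
  obtain ⟨E, hEm, hEanti, hE⟩ := S.exists_continuation_sets (fun n ω => ENNReal.ofReal (B n ω))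
    (fun n => ENNReal.measurable_ofReal.comp (h.adapted n))
    (fun n ω => by simpa using (h.mem_Icc n ω).2)
    (fun ω a b hab => ENNReal.ofReal_le_ofReal (h.antitone ω hab))
  have hle : ∀ n : ℕ, {ω | S.K ω ≤ n} = S.T ⁻¹' Set.Iic (n * S.period) := fun n => by
    ext ω; exact S.K_le_iff ω n
  have heq : ∀ n : ℕ, {ω | S.K ω = n + 1}
      = S.T ⁻¹' {t | ∃ i < S.period, t = n * S.period + 1 + i} := fun n => by
    ext ω; exact S.K_eq_succ_iff ω n
  have hdelay : ∑' n : ℕ, P ({ω | S.K ω ≤ n} ∩ E n) = S.survivalDelay B :=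
    tsum_congr fun n => by simp only [hle, hE]
  have hexit : ∀ n : ℕ, {ω | (n : WithTop ℕ) < exitIndex E ω} = E n := fun n => by
    ext ω; exact lt_exitIndex_iff hEanti ω n
  let π : S.Policy :=
    { stopIndex := exitIndex E
      isStoppingTime := S.isStoppingTime_exitIndex hEanti hEm
      finite := by
        filter_upwards [ae_eventually_notMem (hdelay ▸ hfin)] with ω hω htop
        obtain ⟨n, hn⟩ := Filter.eventually_atTop.1 hω
        refine hn (max n (S.K ω)) (le_max_left _ _)
          ⟨show S.K ω ≤ max n (S.K ω) from le_max_right _ _, ?_⟩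
        rw [← lt_exitIndex_iff hEanti, htop]
        exact WithTop.coe_lt_top _ }
  refine ⟨π, ?_, ?_, ?_⟩
  · have h1 : ∀ n < j, ∀ᵐ ω ∂P, ω ∈ E n := by
      intro n hn
      have h2 := hE n Set.univ
      rw [Set.preimage_univ, Set.univ_inter, Measure.restrict_univ, lintegral_congr_ae
        (g := fun _ => 1) ((h.eq_one n hn).mono fun ω hω => by simp [hω]), lintegral_one,
        measure_univ] at h2
      exact (prob_compl_eq_zero_iff (S.info.le n _ (hEm n))).2 h2
    have h2 : ∀ᵐ ω ∂P, ∀ n < j, ω ∈ E n := by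
      rw [ae_all_iff]
      intro n
      by_cases hn : n < j
      · filter_upwards [h1 n hn] with ω hω _ using hω
      · exact Filter.Eventually.of_forall fun ω h => absurd h hn
    filter_upwards [h2, π.ae_stopIndex_eq] with ω h2 h3
    by_contra hlt
    have h4 : ((π.Kt ω : ℕ) : WithTop ℕ) < exitIndex E ω :=
      (lt_exitIndex_iff hEanti ω _).2 (h2 _ (not_le.1 hlt))
    exact h4.ne' h3
  · rw [π.meanSampledDelay_eq, ← hdelay]
    exact tsum_congr fun n => by rw [← hexit n]
  · rw [π.falseAlarm_eq_tsum]
    refine tsum_congr fun n => ?_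
    have hcompl : {ω | π.stopIndex ω ≤ n} = (E n)ᶜ := by
      rw [← hexit n]
      ext ω
      exact (not_lt (a := (n : WithTop ℕ)) (b := exitIndex E ω)).symm
    have h1 := setLIntegral_ofReal_one_sub (P := P) (h.measurable n) (h.mem_Icc n)
      {ω | S.K ω = n + 1}
    have h2 := measure_inter_add_sdiff (μ := P) {ω | S.K ω = n + 1} (S.info.le n _ (hEm n))
    rw [← h2, add_comm, heq, hE, Set.sdiff_eq] at h1
    simp only [hcompl, heq]
    exact ((ENNReal.add_right_inj (ne_top_of_le_ne_top (measure_ne_top P _) (by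
      rw [← hE n]))).1 h1).symm

theorem exists_prob_lt_K_le [IsProbabilityMeasure P] (S : Model P F₀ F₁ N r ρ p) (j : ℕ)
    {a : ℝ≥0∞} (ha : 0 < a) : ∃ n, j ≤ n ∧ P {ω | n < S.K ω} ≤ a := by
  have hanti : Antitone fun n : ℕ => {ω | n < S.K ω} := fun a b hab ω h =>
    lt_of_le_of_lt hab (show b < S.K ω from h)
  have hm : ∀ n : ℕ, MeasurableSet {ω | n < S.K ω} := fun n => S.measurable_K measurableSet_Ioi
  have h := tendsto_measure_iInter_atTop (μ := P) (fun n => (hm n).nullMeasurableSet)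
    hanti ⟨0, measure_ne_top _ _⟩
  have hempty : ⋂ n : ℕ, {ω | n < S.K ω} = ∅ := by
    ext ω
    simp only [Set.mem_iInter, Set.mem_ofPred_eq, Set.mem_empty_iff_false, iff_false, not_forall]
    exact ⟨S.K ω, lt_irrefl _⟩
  rw [hempty, measure_empty] at h
  obtain ⟨n, hn⟩ := Filter.eventually_atTop.1 (h.eventually_lt_const ha)
  exact ⟨max j n, le_max_left _ _, (hn _ (le_max_right _ _)).le⟩

theorem exists_optimal_policy [IsProbabilityMeasure P] (S : Model P F₀ F₁ N r ρ p) (j : ℕ)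
    {a : ℝ≥0∞} (ha : 0 < a) :
    ∃ π : S.Policy, (∀ᵐ ω ∂P, j ≤ π.Kt ω) ∧ π.falseAlarm ≤ a ∧ π.meanSampledDelay ≠ ∞ ∧
      ∀ π' : S.Policy, (∀ᵐ ω ∂P, j ≤ π'.Kt ω) → π'.falseAlarm ≤ a →
        π.meanSampledDelay ≤ π'.meanSampledDelay := by
  obtain ⟨n, hjn, hn⟩ := S.exists_prob_lt_K_le j ha
  have hjn' : ∀ᵐ ω ∂P, j ≤ (Policy.const S n).Kt ω := Filter.Eventually.of_forall fun _ => hjn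
  have hfa : (Policy.const S n).falseAlarm ≤ a := by
    rw [Policy.falseAlarm_eq]; exact hn
  have hfin : (Policy.const S n).meanSampledDelay ≠ ∞ := by
    refine ne_top_of_le_ne_top (ENNReal.natCast_ne_top n) ?_
    calc (Policy.const S n).meanSampledDelay ≤ ∫⁻ _, (n : ℝ≥0∞) ∂P := by
          refine lintegral_mono fun ω => ?_
          rw [← ENNReal.ofReal_natCast, Policy.const_Kt]
          refine ENNReal.ofReal_le_ofReal (sup_le ?_ (by positivity))
          linarith [(Nat.cast_nonneg (S.K ω) : (0 : ℝ) ≤ S.K ω)]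
      _ = n := by simp
  obtain ⟨B, hB, hBa, hBmin⟩ := S.exists_optimal_survival j a ⟨_, Policy.isSurvival _ hjn', by
    rwa [Policy.survivalAlarm_survival], by rwa [Policy.survivalDelay_survival]⟩
  have hmin : ∀ π' : S.Policy, (∀ᵐ ω ∂P, j ≤ π'.Kt ω) → π'.falseAlarm ≤ a →
      S.survivalDelay B ≤ π'.meanSampledDelay := fun π' h1 h2 => by
    rw [← π'.survivalDelay_survival]
    exact hBmin _ (π'.isSurvival h1) (by rwa [π'.survivalAlarm_survival])
  have hBfin := ne_top_of_le_ne_top hfin (hmin _ hjn' hfa)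
  obtain ⟨π, h1, h2, h3⟩ := hB.exists_policy hBfin
  exact ⟨π, h1, h3 ▸ hBa, h2 ▸ hBfin, fun π' h4 h5 => h2 ▸ hmin π' h4 h5⟩

open scoped Classical in
/-- Follow `π` if the randomization is at most `s`, and halt at batch `j` otherwise. -/
noncomputable def Policy.mix (π : S.Policy) (j : ℕ) (s : ℝ) : S.Policy where
  stopIndex := fun ω => if S.V ω ≤ s then π.stopIndex ω else (j : WithTop ℕ)
  isStoppingTime := fun n => by
    have hV : MeasurableSet[S.info n] {ω | S.V ω ≤ s} := S.measurable_V_info n measurableSet_Iic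
    have h1 : {ω | (if S.V ω ≤ s then π.stopIndex ω else (j : WithTop ℕ)) ≤ (n : WithTop ℕ)}
        = ({ω | S.V ω ≤ s} ∩ {ω | π.stopIndex ω ≤ n}) ∪ ({ω | S.V ω ≤ s}ᶜ ∩ {_ω | j ≤ n}) := by
      ext ω
      by_cases h : S.V ω ≤ s <;> simp [h]
    exact (show MeasurableSet[S.info n] {ω | (if S.V ω ≤ s then π.stopIndex ω
      else (j : WithTop ℕ)) ≤ (n : WithTop ℕ)} from h1 ▸ (hV.inter (π.measurableSet_le n)).union
        (hV.compl.inter (MeasurableSet.const _)))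
  finite := by
    filter_upwards [π.finite] with ω h
    split_ifs
    · exact h
    · exact WithTop.coe_ne_top

theorem Policy.mix_Kt_of_le (π : S.Policy) (j : ℕ) {s : ℝ} {ω : Ω} (h : S.V ω ≤ s) :
    (π.mix j s).Kt ω = π.Kt ω := by
  simp [Policy.Kt, Policy.mix, h]

theorem Policy.mix_Kt_of_gt (π : S.Policy) (j : ℕ) {s : ℝ} {ω : Ω} (h : s < S.V ω) :
    (π.mix j s).Kt ω = j := by
  simp only [Policy.Kt, Policy.mix, not_le.2 h, if_false]
  rfl

theorem continuous_prob_inter_V_le [IsProbabilityMeasure P] (S : Model P F₀ F₁ N r ρ p)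
    (A : Set Ω) : Continuous fun s => P.real (A ∩ {ω | S.V ω ≤ s}) := by
  refine (LipschitzWith.of_le_add fun x y => ?_).continuous
  rcases le_total x y with h | h
  · have : P.real (A ∩ {ω | S.V ω ≤ x}) ≤ P.real (A ∩ {ω | S.V ω ≤ y}) :=
      measureReal_mono (Set.inter_subset_inter_right _ fun ω hω =>
        (show S.V ω ≤ x from hω).trans h)
    linarith [dist_nonneg (x := x) (y := y)]
  · have hsub : A ∩ {ω | S.V ω ≤ x} ⊆ A ∩ {ω | S.V ω ≤ y} ∪ S.V ⁻¹' Set.Ioc y x := by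
      rintro ω ⟨h1, h2⟩
      by_cases h3 : S.V ω ≤ y
      · exact Or.inl ⟨h1, h3⟩
      · exact Or.inr ⟨not_le.1 h3, h2⟩
    have hV : P.real (S.V ⁻¹' Set.Ioc y x) ≤ dist x y := by
      rw [Real.dist_eq, abs_of_nonneg (sub_nonneg.2 h)]
      refine ENNReal.toReal_le_of_le_ofReal (sub_nonneg.2 h) ?_
      rw [← Measure.map_apply S.measurable_V measurableSet_Ioc, S.law_V, ← Real.volume_Ioc]
      exact Measure.restrict_apply_le _ _
    calc P.real (A ∩ {ω | S.V ω ≤ x})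
        ≤ P.real (A ∩ {ω | S.V ω ≤ y} ∪ S.V ⁻¹' Set.Ioc y x) := measureReal_mono hsub
      _ ≤ P.real (A ∩ {ω | S.V ω ≤ y}) + P.real (S.V ⁻¹' Set.Ioc y x) := measureReal_union_le _ _
      _ ≤ _ := by gcongr

theorem ae_V_mem_Ioc (S : Model P F₀ F₁ N r ρ p) : ∀ᵐ ω ∂P, S.V ω ∈ Set.Ioc (0 : ℝ) 1 := by
  have h : ∀ᵐ v ∂(P.map S.V), v ∈ Set.Ioc (0 : ℝ) 1 := by
    rw [S.law_V, ← restrict_Ioc_eq_restrict_Icc]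
    exact ae_restrict_mem measurableSet_Ioc
  exact ae_of_ae_map S.measurable_V.aemeasurable h

/-- An optimal policy may be taken to exhaust the false alarm constraint. -/
theorem exists_optimal_policy_falseAlarm_eq [IsProbabilityMeasure P] (S : Model P F₀ F₁ N r ρ p)
    (j : ℕ) {α : ℝ} (hα : 0 < α) (hK : ENNReal.ofReal α ≤ P {ω | j < S.K ω}) :
    ∃ π : S.Policy, (∀ᵐ ω ∂P, j ≤ π.Kt ω) ∧ π.falseAlarm = ENNReal.ofReal α ∧
      π.meanSampledDelay ≠ ∞ ∧
      ∀ π' : S.Policy, (∀ᵐ ω ∂P, j ≤ π'.Kt ω) → π'.falseAlarm ≤ ENNReal.ofReal α →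
        π.meanSampledDelay ≤ π'.meanSampledDelay := by
  obtain ⟨π, hj, hfa, hfin, hmin⟩ := S.exists_optimal_policy j (ENNReal.ofReal_pos.2 hα)
  have hVm : ∀ s, MeasurableSet {ω | S.V ω ≤ s} := fun s => S.measurable_V measurableSet_Iic
  let A : Set Ω := {ω | π.Kt ω < S.K ω}
  let B : Set Ω := {ω | j < S.K ω}
  let f : ℝ → ℝ := fun s =>
    P.real (A ∩ {ω | S.V ω ≤ s}) + (P.real B - P.real (B ∩ {ω | S.V ω ≤ s}))
  have hf : Continuous f := (S.continuous_prob_inter_V_le A).add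
    (continuous_const.sub (S.continuous_prob_inter_V_le B))
  have hfalse : ∀ s, P.real {ω | (π.mix j s).Kt ω < S.K ω} = f s := by
    intro s
    have h1 := measureReal_inter_add_sdiff (μ := P) (s := {ω | (π.mix j s).Kt ω < S.K ω}) (hVm s)
    have h2 := measureReal_inter_add_sdiff (μ := P) (s := B) (hVm s)
    have e1 : {ω | (π.mix j s).Kt ω < S.K ω} ∩ {ω | S.V ω ≤ s} = A ∩ {ω | S.V ω ≤ s} := by
      ext ω
      refine and_congr_left fun h => ?_
      change (π.mix j s).Kt ω < S.K ω ↔ π.Kt ω < S.K ω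
      rw [π.mix_Kt_of_le j h]
    have e2 : {ω | (π.mix j s).Kt ω < S.K ω} \ {ω | S.V ω ≤ s} = B \ {ω | S.V ω ≤ s} := by
      ext ω
      refine and_congr_left fun h => ?_
      change (π.mix j s).Kt ω < S.K ω ↔ j < S.K ω
      rw [π.mix_Kt_of_gt j (not_le.1 h)]
    rw [e1, e2] at h1
    simp only [f]
    linarith
  have hf0 : α ≤ f 0 := by
    have h0 : P {ω | S.V ω ≤ 0} = 0 := by
      have : ∀ᵐ ω ∂P, ¬ S.V ω ≤ 0 := S.ae_V_mem_Ioc.mono fun ω h => not_le.2 h.1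
      simpa [ae_iff] using this
    have h1 : ∀ C : Set Ω, P.real (C ∩ {ω | S.V ω ≤ 0}) = 0 := fun C => by
      rw [measureReal_def, measure_mono_null Set.inter_subset_right h0, ENNReal.toReal_zero]
    simp only [f, h1]
    have := (ENNReal.ofReal_le_iff_le_toReal (measure_ne_top _ _)).1 hK
    simpa [measureReal_def] using this
  have hf1 : f 1 ≤ α := by
    have h1 : ∀ C : Set Ω, P.real (C ∩ {ω | S.V ω ≤ 1}) = P.real C := fun C => by
      refine congrArg ENNReal.toReal (measure_congr (Filter.eventuallyEq_set.2 ?_))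
      filter_upwards [S.ae_V_mem_Ioc] with ω h
      exact and_iff_left h.2
    simp only [f, h1]
    rw [π.falseAlarm_eq] at hfa
    have := ENNReal.toReal_le_of_le_ofReal hα.le hfa
    simpa [measureReal_def] using this
  obtain ⟨s, -, hs⟩ := intermediate_value_Icc' zero_le_one hf.continuousOn ⟨hf1, hf0⟩
  have hKt : ∀ᵐ ω ∂P, j ≤ (π.mix j s).Kt ω ∧ (π.mix j s).Kt ω ≤ π.Kt ω := by
    filter_upwards [hj] with ω h
    rcases le_or_gt (S.V ω) s with hV | hV
    · rw [π.mix_Kt_of_le j hV]; exact ⟨h, le_rfl⟩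
    · rw [π.mix_Kt_of_gt j hV]; exact ⟨le_rfl, h⟩
  have hdelay : (π.mix j s).meanSampledDelay ≤ π.meanSampledDelay := by
    refine lintegral_mono_ae ?_
    filter_upwards [hKt] with ω h
    have : ((π.mix j s).Kt ω : ℝ) ≤ π.Kt ω := by exact_mod_cast h.2
    gcongr
  refine ⟨π.mix j s, hKt.mono fun ω h => h.1, ?_, ne_top_of_le_ne_top hfin hdelay,
    fun π' h1 h2 => hdelay.trans (hmin π' h1 h2)⟩
  rw [Policy.falseAlarm_eq, ← hs, ← hfalse s, measureReal_def,
    ENNReal.ofReal_toReal (measure_ne_top _ _)]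

/-- Minimal mean detection delay over the policies that wait for batch `j`. -/
theorem isLeast_meanDetectionDelay [IsProbabilityMeasure P] (S : Model P F₀ F₁ N r ρ p)
    {j : ℕ} {α d : ℝ} (hρ : 0 ≤ ρ) (hp : 0 < p) (hp' : p ≤ 1) (hα : 0 < α) (hα' : α < 1 - ρ)
    (hd : S.SojournStationary j d) (hK : ENNReal.ofReal α ≤ P {ω | j < S.K ω})
    {Q : Set S.Policy}
    (hQ : ∀ π, π ∈ Q ↔ π.falseAlarm ≤ ENNReal.ofReal α ∧ ∀ᵐ ω ∂P, j ≤ π.Kt ω) :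
    ∃ m : ℝ, 0 ≤ m ∧ IsLeast (Policy.meanSampledDelay '' Q) (ENNReal.ofReal m) ∧
      IsLeast (Policy.meanDetectionDelay '' Q)
        (ENNReal.ofReal ((d + coarseDelay p r) * (1 - α) - ρ * coarseDelay p r + 1 / r * m)) := by
  obtain ⟨π, hj, hfa, hfin, hmin⟩ := S.exists_optimal_policy_falseAlarm_eq j hα hK
  have hl := S.coarseDelay_nonneg hp hp'
  have hr : 0 ≤ 1 / r := (one_div_pos.2 S.rate_pos).le
  have hnn : 0 ≤ (d + coarseDelay p r) * (1 - α) - ρ * coarseDelay p r := by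
    nlinarith [mul_nonneg hd.nonneg (show 0 ≤ 1 - α by linarith),
      mul_nonneg hl (show 0 ≤ 1 - α - ρ by linarith)]
  have hval : ENNReal.ofReal ((d + coarseDelay p r) * (1 - α) - ρ * coarseDelay p r
        + 1 / r * π.meanSampledDelay.toReal)
      = ENNReal.ofReal ((d + coarseDelay p r) * (1 - α) - ρ * coarseDelay p r)
        + ENNReal.ofReal (1 / r) * π.meanSampledDelay := by
    rw [ENNReal.ofReal_add hnn (mul_nonneg hr ENNReal.toReal_nonneg), ENNReal.ofReal_mul hr,
      ENNReal.ofReal_toReal hfin]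
  refine ⟨π.meanSampledDelay.toReal, ENNReal.toReal_nonneg, ⟨⟨π, (hQ π).2 ⟨hfa.le, hj⟩, ?_⟩, ?_⟩,
    ⟨⟨π, (hQ π).2 ⟨hfa.le, hj⟩, ?_⟩, ?_⟩⟩
  · rw [ENNReal.ofReal_toReal hfin]
  · rintro _ ⟨π', hπ', rfl⟩
    rw [ENNReal.ofReal_toReal hfin]
    exact hmin π' ((hQ π').1 hπ').2 ((hQ π').1 hπ').1
  · rw [hval, π.meanDetectionDelay_eq hρ hp hp' hd hj hα.le hα'.le hfa]
  · rintro _ ⟨π', hπ', rfl⟩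
    obtain ⟨hfa', hj'⟩ := (hQ π').1 hπ'
    have ha : π'.falseAlarm.toReal ≤ α := ENNReal.toReal_le_of_le_ofReal hα.le hfa'
    rw [hval, π'.meanDetectionDelay_eq hρ hp hp' hd hj' ENNReal.toReal_nonneg
      (ha.trans hα'.le) (ENNReal.ofReal_toReal (measure_ne_top _ _)).symm]
    gcongr
    · exact add_nonneg hd.nonneg hl
    · exact hmin π' hj' hfa'

end Model
end NODM

theorem theorem1 {Ω 𝒳 : Type*} [MeasurableSpace Ω] [MeasurableSpace 𝒳]
    (P : Measure Ω) [IsProbabilityMeasure P]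
    (F₀ F₁ : Measure 𝒳) [IsProbabilityMeasure F₀] [IsProbabilityMeasure F₁]
    (N : ℕ) (hN : 1 ≤ N) (r ρ p α d : ℝ)
    (hρ : 0 ≤ ρ) (hp : 0 < p) (hp' : p ≤ 1) (hα : 0 < α) (hα' : α < 1 - ρ)
    (S : NODM.Model P F₀ F₁ N r ρ p) :
    -- `l(r)` is the mean coarse-sampling delay
    (∫ ω, ((S.K ω : ℝ) / r - (S.T ω : ℝ)) ∂(P[|{ω | 0 < S.T ω}]) = NODM.coarseDelay p r) ∧
    -- the sojourn time charged for stopping before the first batch is also a stationary one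
    (S.SojournStationary 0 d →
      ∃ m : ℝ, 0 ≤ m ∧
        IsLeast (NODM.Model.Policy.meanSampledDelay '' S.policies α) (ENNReal.ofReal m) ∧
        IsLeast (NODM.Model.Policy.meanDetectionDelay '' S.policies α)
          (ENNReal.ofReal ((d + NODM.coarseDelay p r) * (1 - α) - ρ * NODM.coarseDelay p r
            + 1 / r * m))) ∧
    (S.SojournStationary 1 d →
      α ≤ (1 - ρ) * (1 - NODM.sampledChangeProb p r) →
      ∃ m : ℝ, 0 ≤ m ∧
        IsLeast (NODM.Model.Policy.meanSampledDelay '' S.waitingPolicies α) (ENNReal.ofReal m) ∧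
        IsLeast (NODM.Model.Policy.meanDetectionDelay '' S.waitingPolicies α)
          (ENNReal.ofReal ((d + NODM.coarseDelay p r) * (1 - α) - ρ * NODM.coarseDelay p r
            + 1 / r * m))) := by
  refine ⟨S.integral_coarse_sampling_delay hρ (by linarith) hp hp', fun hd => ?_, fun hd hαK => ?_⟩
  · refine S.isLeast_meanDetectionDelay hρ hp hp' hα hα' hd ?_ fun π => ?_
    · rw [S.prob_K_pos hρ]
      exact ENNReal.ofReal_le_ofReal hα'.le
    · simp [NODM.Model.policies]
  · refine S.isLeast_meanDetectionDelay hρ hp hp' hα hα' hd ?_ fun π => Iff.rfl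
    rw [S.prob_K_gt_one hρ (by linarith) hp hp']
    exact ENNReal.ofReal_le_ofReal hαK
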